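/- A layered tree is a finite rooted tree with nonnegative real edge lengths; its root is the source, its $i$-th layer is the (nonempty) set of nodes at combinatorial depth $i$, and its target is a node of the last layer. In layered tree traversal a searcher starts at the source; at step $i$ the $i$-th layer is revealed together with the edges (and their lengths) that join it to layer $i-1$, and the searcher must move to a node of layer $i$ along revealed edges; after the last layer is revealed it moves to the target. A deterministic algorithm maps the sequence of revealed layers and the position of the searcher in the last but one layer to its position in the last layer, and its cost $\mathrm{Cost}(\mathcal A,T)$ is the total length traversed until the target is attained. A randomized algorithm is a probability distribution over deterministic algorithms. There exist randomized algorithms $\{\mathcal{A}_k\}_{k\ge 1}$ for layered tree traversal and an absolute constant $C$ such that for every $k\ge 1$ and every layered tree $T$, $$\mathbb{E}\big(\mathrm{Cost}(\mathcal{A}_k,T)\big)\le \frac{2L}{k}+C\,kD,$$ where $L$ is the sum of all edge lengths of $T$ and $D$ is the distance from the source to the target. Moreover, there is an absolute constant $C'$ such that for every $w\ge 1$ and every layered tree $T$ all of whose edges have length $1$ and all of whose layers have at most $w$ nodes, the choice $k=\lfloor\sqrt{w}\rfloor$ gives $$\mathbb{E}\big(\mathrm{Cost}(\mathcal{A}_{\lfloor\sqrt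 w\rfloor},T)\big)\le C'\sqrt{w}\,D.$$ -/

import Mathlib

open MeasureTheory
open scoped NNReal

/-- A (revealed prefix of a) finite layered tree with nonnegative real edge lengths, presented layer
by layer; the index is the number of nodes of the last layer. Layer `0` consists of the source.
A further layer consists of `n ≥ 1` nodes, each joined by one edge to its parent in the preceding
layer. Nodes of a layer may be childless, and edges of length `0` are allowed. -/
inductive LayeredTree : ℕ → Type
  | source : LayeredTree 1
  | addLayer {m : ℕ} (T : LayeredTree m) (n : ℕ) (hn : 0 < n) (parent : Fin n → Fin m)
      (len : Fin n → ℝ≥0) : LayeredTree n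

namespace LayeredTree

/-- The sum of all edge lengths. -/
noncomputable def length : {m : ℕ} → LayeredTree m → ℝ
  | _, source => 0
  | _, addLayer T _ _ _ len => T.length + ∑ v, (len v : ℝ)

/-- The maximum number of nodes of a layer. -/
def width : {m : ℕ} → LayeredTree m → ℕ
  | _, source => 1
  | _, addLayer T n _ _ _ => max T.width n

/-- All edges have length `1`. -/
def UnitLengths : {m : ℕ} → LayeredTree m → Prop
  | _, source => True
  | _, addLayer T _ _ _ len => T.UnitLengths ∧ ∀ v, len v = 1

/-- The distance from the source to a node of the last layer. -/
noncomputable def depth : {m : ℕ} → LayeredTree m → Fin m → ℝ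
  | _, source, _ => 0
  | _, addLayer T _ _ parent len, v => T.depth (parent v) + len v

/-- The tree distance between two nodes of the last layer: the total length of the edges that lead
from either node up to their lowest common ancestor. -/
noncomputable def dist : {m : ℕ} → LayeredTree m → Fin m → Fin m → ℝ
  | _, source, _, _ => 0
  | _, addLayer T _ _ parent len, u, v =>
      if u = v then 0 else len u + T.dist (parent u) (parent v) + len v

/-- What a searcher faces at one step: the layers `tree` revealed so far, the position `pos` of the
searcher in the last of them, and the newly revealed layer with its edges. -/
structure Situation where
  m : ℕ
  tree : LayeredTree m
  pos : Fin m
  n : ℕ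
  hn : 0 < n
  parent : Fin n → Fin m
  len : Fin n → ℝ≥0

/-- A deterministic algorithm for layered tree traversal: it maps the sequence of revealed layers and
the position of the searcher in the last but one layer to a position in the last layer. -/
def DetAlgorithm : Type := (s : Situation) → Fin s.n

/-- The product σ-algebra (each `Fin n` being discrete). -/
instance : MeasurableSpace DetAlgorithm :=
  inferInstanceAs (MeasurableSpace ((s : Situation) → Fin s.n))

/-- A randomized algorithm is a probability distribution over deterministic algorithms. -/
abbrev RandAlgorithm : Type := ProbabilityMeasure DetAlgorithm

/-- The position, in the last layer, of a searcher that starts at the source and follows `A`. -/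
def position (A : DetAlgorithm) : {m : ℕ} → (T : LayeredTree m) → Fin m
  | _, source => 0
  | _, addLayer (m := m) T n hn parent len =>
      A { m := m, tree := T, pos := position A T, n := n, hn := hn, parent := parent, len := len }

/-- The distance travelled by the searcher until it has moved to the last layer. In each step it
moves from its position `x` to a node `v` of the next layer; the path from `x` to `v` ends with the
edge from the parent of `v` to `v`. -/
noncomputable def travelled (A : DetAlgorithm) : {m : ℕ} → LayeredTree m → ℝ
  | _, source => 0
  | _, addLayer T n hn parent len =>
      travelled A T
        + (T.dist (position A T) (parent (position A (addLayer T n hn parent len)))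
          + len (position A (addLayer T n hn parent len)))

/-- The cost of `A` on the layered tree `T` with target `t` in the last layer: the total distance
travelled by the searcher to attain the target. (The last step is void if the last layer is `{t}`.) -/
noncomputable def cost (A : DetAlgorithm) {m : ℕ} (T : LayeredTree m) (t : Fin m) : ℝ :=
  travelled A T + T.dist (position A T) t

end LayeredTree

/-! Read edge lengths as resistances and let the searcher's position be distributed as the unit
electrical current `x` from the source into the last layer, every node of which is grounded. This
fractional strategy does not depend on `k`; for every `κ ≥ 1` its cost is at most `42 * (L / κ + κ *
D)`, and `κ = 21 * k` gives the theorem, with a single algorithm serving all `k`.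

The cost is amortized against the potential function `pot`, the sum of three terms: edge lengths
weighted by `√x`, divided by `√κ`; twice the total length minus the length still carrying current,
divided by `κ`; and `κ` times the source potential `V`, the effective resistance. Only upward
movement has to be paid for, since all movement is twice the upward movement plus the net change of
mean depth (`edgeSum_abs_eq`). Finally `pot` is `O(L / κ + κ * V)` and `V ≤ D`.

A new layer acts in two stages. Childless nodes of the old layer stop being targets one at a time
(`exists_erase_bound`). Losing a branch of length `W` that carried current `X` moves at most `W * X
+ δ` upwards, where `δ` is the rise of the potential at the attachment point. If the siblings there
carry at least `X`, the drop along the branch bounds `δ`; otherwise the current is redistributed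
over edges that carried little, and the square-root term grows enough to pay for `δ`. The remaining
targets are then extended to their children (`posPart_add_le_of_addLayer`), which AM-GM pays for.

Zero lengths would make the flow degenerate, so all lengths are increased by `ε` (`stretch`) and an
ultrafilter limit of the flows is taken (`exists_fractional_strategy`). A fractional strategy
becomes a randomized algorithm by optimal transport between consecutive distributions, the decisions
in all situations being drawn independently (`exists_randAlgorithm`). -/

namespace LayeredTree

open Finset

/-! ### Flows on a layered tree -/

/-- The image of a mass distribution on a layer under the parent map. -/
noncomputable def push {n m : ℕ} (parent : Fin n → Fin m) (x : Fin n → ℝ) : Fin m → ℝ :=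
  fun p => ∑ v with parent v = p, x v

/-- The sum over all edges `e` of `len e * f (x e) (y e)`, where `x e` and `y e` are the masses that
the distributions `x` and `y` on the last layer put below `e`. -/
noncomputable def edgeSum (f : ℝ → ℝ → ℝ) :
    {m : ℕ} → LayeredTree m → (Fin m → ℝ) → (Fin m → ℝ) → ℝ
  | _, source, _, _ => 0
  | _, addLayer T _ _ parent len, x, y =>
      edgeSum f T (push parent x) (push parent y) + ∑ v, (len v : ℝ) * f (x v) (y v)

/-- All edge lengths are positive. -/
def PosLengths : {m : ℕ} → LayeredTree m → Prop
  | _, source => True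
  | _, addLayer T _ _ _ len => T.PosLengths ∧ ∀ v, 0 < len v

/-- `x` is a unit electrical flow from the source to the set `S` of nodes of the last layer, where
each edge has its length as resistance, `U` is the potential on `S` and `V` that of the source. -/
def IsElectric : {m : ℕ} → LayeredTree m → Finset (Fin m) → (Fin m → ℝ) → (Fin m → ℝ) → ℝ → Prop
  | _, source, S, x, U, V => 0 ∈ S ∧ x 0 = 1 ∧ 0 ≤ U 0 ∧ U 0 = V
  | _, addLayer T _ _ parent len, S, x, U, V =>
      (∀ v ∈ S, 0 < x v ∧ 0 ≤ U v) ∧ (∀ v ∉ S, x v = 0) ∧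
        ∃ U₀, IsElectric T (S.image parent) (push parent x) U₀ V ∧
          ∀ v ∈ S, U₀ (parent v) = U v + len v * x v

lemma sum_push {n m : ℕ} (parent : Fin n → Fin m) (x : Fin n → ℝ) :
    ∑ p, push parent x p = ∑ v, x v :=
  Finset.sum_fiberwise univ parent x

lemma sum_push_mul {n m : ℕ} (parent : Fin n → Fin m) (x : Fin n → ℝ) (g : Fin m → ℝ) :
    ∑ p, push parent x p * g p = ∑ v, x v * g (parent v) := by
  rw [← Finset.sum_fiberwise univ parent]
  refine sum_congr rfl fun p _ => ?_
  rw [push, sum_mul]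
  refine sum_congr rfl fun v hv => ?_
  rw [(mem_filter.1 hv).2]

lemma push_nonneg {n m : ℕ} (parent : Fin n → Fin m) {x : Fin n → ℝ} (hx : ∀ v, 0 ≤ x v)
    (p : Fin m) : 0 ≤ push parent x p :=
  sum_nonneg fun v _ => hx v

lemma le_push {n m : ℕ} (parent : Fin n → Fin m) {x : Fin n → ℝ} (hx : ∀ v, 0 ≤ x v)
    (v : Fin n) : x v ≤ push parent x (parent v) :=
  single_le_sum (f := x) (fun v _ => hx v) (by simp)

lemma push_eq_zero {n m : ℕ} (parent : Fin n → Fin m) {x : Fin n → ℝ} {S : Finset (Fin n)}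
    (hx : ∀ v ∉ S, x v = 0) {p : Fin m} (hp : p ∉ S.image parent) : push parent x p = 0 := by
  refine sum_eq_zero fun v hv => hx v fun hvS => hp ?_
  rw [← (mem_filter.1 hv).2]
  exact mem_image_of_mem _ hvS

lemma push_eq_sum {n m : ℕ} (parent : Fin n → Fin m) {x : Fin n → ℝ} {S : Finset (Fin n)}
    (hx : ∀ v ∉ S, x v = 0) (p : Fin m) :
    push parent x p = ∑ v ∈ S with parent v = p, x v := by
  symm
  refine sum_subset (filter_subset_filter _ (subset_univ S)) fun v hv hv' => hx v fun hvS => hv' ?_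
  exact mem_filter.2 ⟨hvS, (mem_filter.1 hv).2⟩

/-! ### Algebra of sums over edges -/

lemma edgeSum_swap (f : ℝ → ℝ → ℝ) {m : ℕ} (T : LayeredTree m) (x y : Fin m → ℝ) :
    edgeSum f T x y = edgeSum (fun a b => f b a) T y x := by
  induction T with
  | source => rfl
  | addLayer T n hn parent len ih => rw [edgeSum, edgeSum, ih]

lemma edgeSum_add (f g : ℝ → ℝ → ℝ) {m : ℕ} (T : LayeredTree m) (x y : Fin m → ℝ) :
    edgeSum (fun a b => f a b + g a b) T x y = edgeSum f T x y + edgeSum g T x y := by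
  induction T with
  | source => simp [edgeSum]
  | addLayer T n hn parent len ih =>
    simp only [edgeSum, ih, mul_add, sum_add_distrib]
    ring

lemma edgeSum_const_mul (c : ℝ) (f : ℝ → ℝ → ℝ) {m : ℕ} (T : LayeredTree m) (x y : Fin m → ℝ) :
    edgeSum (fun a b => c * f a b) T x y = c * edgeSum f T x y := by
  induction T with
  | source => simp [edgeSum]
  | addLayer T n hn parent len ih =>
    simp only [edgeSum, ih, mul_add, mul_sum]
    congr 1
    exact sum_congr rfl fun v _ => by ring

lemma edgeSum_mono {f g : ℝ → ℝ → ℝ} (hfg : ∀ a b, 0 ≤ a → 0 ≤ b → f a b ≤ g a b) {m : ℕ}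
    (T : LayeredTree m) {x y : Fin m → ℝ} (hx : ∀ v, 0 ≤ x v) (hy : ∀ v, 0 ≤ y v) :
    edgeSum f T x y ≤ edgeSum g T x y := by
  induction T with
  | source => exact le_rfl
  | addLayer T n hn parent len ih =>
    rw [edgeSum, edgeSum]
    refine add_le_add (ih (push_nonneg parent hx) (push_nonneg parent hy)) (sum_le_sum fun v _ => ?_)
    exact mul_le_mul_of_nonneg_left (hfg _ _ (hx v) (hy v)) (len v).2

lemma edgeSum_nonneg {f : ℝ → ℝ → ℝ} (hf : ∀ a b, 0 ≤ f a b) {m : ℕ} (T : LayeredTree m)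
    (x y : Fin m → ℝ) : 0 ≤ edgeSum f T x y := by
  induction T with
  | source => exact le_rfl
  | addLayer T n hn parent len ih =>
    exact add_nonneg (ih _ _) (sum_nonneg fun v _ => mul_nonneg (len v).2 (hf _ _))

lemma edgeSum_one {m : ℕ} (T : LayeredTree m) (x y : Fin m → ℝ) :
    edgeSum (fun _ _ => 1) T x y = T.length := by
  induction T with
  | source => rfl
  | addLayer T n hn parent len ih => simp [edgeSum, length, ih]

/-- A sum over edges that depends on the first distribution only. -/
lemma edgeSum_left (f : ℝ → ℝ) {m : ℕ} (T : LayeredTree m) (x y y' : Fin m → ℝ) :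
    edgeSum (fun a _ => f a) T x y = edgeSum (fun a _ => f a) T x y' := by
  induction T with
  | source => rfl
  | addLayer T n hn parent len ih => rw [edgeSum, edgeSum, ih _ _ (push parent y')]

lemma edgeSum_diag (f : ℝ → ℝ → ℝ) {m : ℕ} (T : LayeredTree m) (x : Fin m → ℝ) :
    edgeSum f T x x = edgeSum (fun a _ => f a a) T x x := by
  induction T with
  | source => rfl
  | addLayer T n hn parent len ih => rw [edgeSum, edgeSum, ih]

/-- Comparison of two sums along a section of `f`. -/
lemma sum_le_sum_of_section {α β : Type*} [DecidableEq β] {A : Finset α} {B : Finset β}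
    {f : α → β} {F : α → ℝ} {G : β → ℝ} (hF : ∀ a ∈ A, 0 ≤ F a)
    (h : ∀ b ∈ B, ∃ a ∈ A, f a = b ∧ G b ≤ F a) : ∑ b ∈ B, G b ≤ ∑ a ∈ A, F a := by
  calc ∑ b ∈ B, G b ≤ ∑ b ∈ B, ∑ a ∈ A with f a = b, F a := by
        refine sum_le_sum fun b hb => ?_
        obtain ⟨a, ha, hab, hG⟩ := h b hb
        exact hG.trans (single_le_sum (f := F) (fun a ha => hF a (mem_filter.1 ha).1)
          (mem_filter.2 ⟨ha, hab⟩))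
    _ = ∑ a ∈ A with f a ∈ B, F a := by
        rw [← sum_fiberwise_of_maps_to (s := {a ∈ A | f a ∈ B}) (t := B) (g := f) (by simp)]
        refine sum_congr rfl fun b hb => sum_congr ?_ fun _ _ => rfl
        ext a
        simp only [mem_filter]
        constructor
        · rintro ⟨h1, rfl⟩; exact ⟨⟨h1, hb⟩, rfl⟩
        · rintro ⟨⟨h1, _⟩, h2⟩; exact ⟨h1, h2⟩
    _ ≤ ∑ a ∈ A, F a := sum_le_sum_of_subset_of_nonneg (filter_subset _ _) fun a ha _ => hF a ha

/-- The slope of the chord of the square root. -/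
noncomputable def sqrtSlope (a b : ℝ) : ℝ := 1 / (√a + √b)

lemma sqrtSlope_mul {a b : ℝ} (ha : 0 ≤ a) (hb : 0 ≤ b) :
    sqrtSlope a b * (a - b) = √a - √b := by
  unfold sqrtSlope
  rcases ha.eq_or_lt with rfl | ha'
  · rcases hb.eq_or_lt with rfl | hb'
    · simp
    · have := Real.sqrt_pos.2 hb'
      field_simp
      nlinarith [Real.sq_sqrt hb, Real.sqrt_zero]
  · have := Real.sqrt_pos.2 ha'
    have := Real.sqrt_nonneg b
    field_simp
    nlinarith [Real.sq_sqrt hb, Real.sq_sqrt ha]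

/-- A child carries no more current than its parent, so its chord is steeper. This drives the
layer-by-layer telescoping of the square-root sums. -/
lemma sqrtSlope_anti {a b a' b' : ℝ} (ha : 0 < a) (haa : a ≤ a') (hbb : b ≤ b') :
    sqrtSlope a' b' ≤ sqrtSlope a b := by
  have := Real.sqrt_pos.2 ha
  have := Real.sqrt_nonneg b
  unfold sqrtSlope
  gcongr

lemma sqrtSlope_nonneg (a b : ℝ) : 0 ≤ sqrtSlope a b := by
  unfold sqrtSlope; positivity

/-! ### Reciprocity and monotonicity for electrical flows -/

namespace IsElectric

variable {m : ℕ} {T : LayeredTree m} {S : Finset (Fin m)} {x U : Fin m → ℝ} {V : ℝ}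

lemma pos (h : IsElectric T S x U V) {v : Fin m} (hv : v ∈ S) : 0 < x v := by
  cases T with
  | source =>
    obtain ⟨_, h1, _⟩ := h
    rw [Subsingleton.elim v 0, h1]; exact one_pos
  | addLayer T n hn parent len => exact (h.1 v hv).1

lemma eq_zero (h : IsElectric T S x U V) {v : Fin m} (hv : v ∉ S) : x v = 0 := by
  cases T with
  | source => exact absurd (Subsingleton.elim v 0 ▸ h.1) hv
  | addLayer T n hn parent len => exact h.2.1 v hv

lemma nonneg (h : IsElectric T S x U V) (v : Fin m) : 0 ≤ x v := by
  by_cases hv : v ∈ S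
  · exact (h.pos hv).le
  · exact (h.eq_zero hv).ge

lemma potential_nonneg (h : IsElectric T S x U V) {v : Fin m} (hv : v ∈ S) : 0 ≤ U v := by
  cases T with
  | source => rw [Subsingleton.elim v 0]; exact h.2.2.1
  | addLayer T n hn parent len => exact (h.1 v hv).2

lemma sum_eq_one (h : IsElectric T S x U V) : ∑ v, x v = 1 := by
  induction T with
  | source => simpa using h.2.1
  | addLayer T n hn parent len ih =>
    obtain ⟨_, _, U₀, h₀, _⟩ := h
    rw [← sum_push parent]
    exact ih h₀

lemma le_one (h : IsElectric T S x U V) (v : Fin m) : x v ≤ 1 :=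
  h.sum_eq_one ▸ single_le_sum (f := x) (fun v _ => h.nonneg v) (mem_univ v)

/-- Reciprocity: the electrical flow pairs with every unit flow to the potential of the source. -/
lemma edgeSum_mul_add (h : IsElectric T S x U V) {y : Fin m → ℝ} (hy : ∀ v ∉ S, y v = 0)
    (hy1 : ∑ v, y v = 1) : edgeSum (fun a b => a * b) T x y + ∑ v, y v * U v = V := by
  induction T with
  | source =>
    obtain ⟨_, _, _, h3⟩ := h
    have : y 0 = 1 := by simpa using hy1
    simp [edgeSum, this, h3]
  | addLayer T n hn parent len ih =>
    obtain ⟨_, _, U₀, h₀, hU⟩ := h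
    have := ih h₀ (y := push parent y) (fun p hp => push_eq_zero parent hy hp)
      ((sum_push parent y).trans hy1)
    rw [← this, sum_push_mul, edgeSum, add_assoc, ← sum_add_distrib]
    congr 1
    refine sum_congr rfl fun v _ => ?_
    by_cases hv : v ∈ S
    · rw [hU v hv]; ring
    · rw [hy v hv]; ring

variable {V' : ℝ} {x' U' : Fin m → ℝ}

/-- Monotonicity of the effective resistances passes to the parent layer. -/
lemma mul_le_mul_parent {m n : ℕ} {parent : Fin n → Fin m} {len : Fin n → ℝ≥0}
    {S : Finset (Fin n)} {x U x' U' : Fin n → ℝ} {U₀ U₀' : Fin m → ℝ}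
    (hx : ∀ v ∉ S, x v = 0) (hx' : ∀ v ∉ S, x' v = 0)
    (hU : ∀ v ∈ S, U₀ (parent v) = U v + len v * x v)
    (hU' : ∀ v ∈ S, U₀' (parent v) = U' v + len v * x' v)
    (hM : ∀ v ∈ S, U v * x' v ≤ U' v * x v) (p : Fin m) :
    U₀ p * push parent x' p ≤ U₀' p * push parent x p := by
  rw [push_eq_sum parent hx, push_eq_sum parent hx', mul_sum, mul_sum]
  refine sum_le_sum fun v hv => ?_
  obtain ⟨hvS, rfl⟩ := mem_filter.1 hv
  rw [hU v hvS, hU' v hvS]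
  nlinarith [hM v hvS]

/-- If effective resistances increase, then so do the potentials. -/
lemma potential_mono (h : IsElectric T S x U V) (h' : IsElectric T S x' U' V')
    (hM : ∀ v ∈ S, U v * x' v ≤ U' v * x v) : ∀ v ∈ S, U v ≤ U' v := by
  induction T with
  | source =>
    intro v hv
    have := hM v hv
    rw [Subsingleton.elim v 0, h.2.1, h'.2.1] at this
    rw [Subsingleton.elim v 0]
    linarith
  | addLayer T n hn parent len ih =>
    intro v hv
    have hpos := h.pos hv
    have hUn := h.potential_nonneg hv
    obtain ⟨_, hx, U₀, h₀, hU⟩ := h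
    obtain ⟨_, hx', U₀', h₀', hU'⟩ := h'
    have h1 := ih h₀ h₀' (fun p _ => mul_le_mul_parent hx hx' hU hU' hM p) (parent v)
      (mem_image_of_mem _ hv)
    rw [hU v hv, hU' v hv] at h1
    -- If the potential at `v` fell while that of its parent did not, the current into `v` would
    -- have risen, so the effective resistance below `v` would have dropped, against `hM`.
    by_contra! hlt
    have h2 := hM v hv
    have h3 : x v < x' v := by
      by_contra! h3
      nlinarith [(len v).2, mul_le_mul_of_nonneg_left h3 (len v).2]
    nlinarith [mul_le_mul_of_nonneg_left h3.le hUn]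

/-- The length traversed upwards when the flow changes is at most the total increase of the
potentials. -/
lemma edgeSum_posPart_le (h : IsElectric T S x U V) (h' : IsElectric T S x' U' V')
    (hM : ∀ v ∈ S, U v * x' v ≤ U' v * x v) :
    edgeSum (fun a b => max (a - b) 0) T x x' ≤ ∑ v ∈ S with x' v < x v, (U' v - U v) := by
  induction T with
  | source =>
    rw [edgeSum]
    exact sum_nonneg fun v hv => sub_nonneg.2 (h.potential_mono h' hM v (mem_filter.1 hv).1)
  | addLayer T n hn parent len ih =>
    obtain ⟨_, hx, U₀, h₀, hU⟩ := id h
    obtain ⟨_, hx', U₀', h₀', hU'⟩ := id h'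
    have hM₀ : ∀ p ∈ S.image parent, U₀ p * push parent x' p ≤ U₀' p * push parent x p :=
      fun p _ => mul_le_mul_parent hx hx' hU hU' hM p
    have hδ := h₀.potential_mono h₀' hM₀
    have h1 := ih h₀ h₀' hM₀
    have h2 : ∑ v, (len v : ℝ) * max (x v - x' v) 0
        = ∑ v ∈ S with x' v < x v, ((U' v - U v) - (U₀' (parent v) - U₀ (parent v))) := by
      rw [← sum_subset (subset_univ {v ∈ S | x' v < x v})]
      · refine sum_congr rfl fun v hv => ?_
        obtain ⟨hvS, hlt⟩ := mem_filter.1 hv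
        rw [max_eq_left (sub_nonneg.2 hlt.le), hU v hvS, hU' v hvS]
        ring
      · intro v _ hv
        by_cases hvS : v ∈ S
        · have : x v ≤ x' v := not_lt.1 fun hlt => hv (mem_filter.2 ⟨hvS, hlt⟩)
          rw [max_eq_right (sub_nonpos.2 this), mul_zero]
        · rw [hx v hvS, hx' v hvS, sub_self, max_self, mul_zero]
    -- A node that loses current has a child that loses current. Choosing one such child for each
    -- node makes the potential increases telescope.
    have h3 : ∑ p ∈ S.image parent with push parent x' p < push parent x p, (U₀' p - U₀ p)
        ≤ ∑ v ∈ S with x' v < x v, (U₀' (parent v) - U₀ (parent v)) := by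
      refine sum_le_sum_of_section (f := parent) (fun v hv => sub_nonneg.2 (hδ _
        (mem_image_of_mem _ (mem_filter.1 hv).1))) fun p hp => ?_
      obtain ⟨hp, hlt⟩ := mem_filter.1 hp
      rw [push_eq_sum parent hx, push_eq_sum parent hx'] at hlt
      obtain ⟨v, hv, hvlt⟩ := exists_lt_of_sum_lt hlt
      obtain ⟨hvS, rfl⟩ := mem_filter.1 hv
      exact ⟨v, mem_filter.2 ⟨hvS, hvlt⟩, rfl, le_rfl⟩
    rw [edgeSum, h2, sum_sub_distrib]
    linarith

/-- By Ohm's law the change of `len * √x` on an edge is the chord slope times the difference between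
the potential increases at its two ends. Slopes grow towards the leaves, so the contributions of
inner nodes cancel favourably and only the last layer remains. -/
lemma edgeSum_sqrt_sub_le (h : IsElectric T S x U V) (h' : IsElectric T S x' U' V')
    (hM : ∀ v ∈ S, U v * x' v ≤ U' v * x v) :
    edgeSum (fun a _ => √a) T x x - edgeSum (fun a _ => √a) T x' x'
      ≤ ∑ v ∈ S, sqrtSlope (x v) (x' v) * (U' v - U v) := by
  induction T with
  | source =>
    rw [edgeSum, edgeSum, sub_zero]
    exact sum_nonneg fun v hv => mul_nonneg (sqrtSlope_nonneg _ _)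
      (sub_nonneg.2 (h.potential_mono h' hM v hv))
  | addLayer T n hn parent len ih =>
    obtain ⟨_, hx, U₀, h₀, hU⟩ := id h
    obtain ⟨_, hx', U₀', h₀', hU'⟩ := id h'
    have hM₀ : ∀ p ∈ S.image parent, U₀ p * push parent x' p ≤ U₀' p * push parent x p :=
      fun p _ => mul_le_mul_parent hx hx' hU hU' hM p
    have hδ := h₀.potential_mono h₀' hM₀
    have h1 := ih h₀ h₀' hM₀
    have h3 : ∑ p ∈ S.image parent, sqrtSlope (push parent x p) (push parent x' p) * (U₀' p - U₀ p)
        ≤ ∑ v ∈ S, sqrtSlope (x v) (x' v) * (U₀' (parent v) - U₀ (parent v)) := by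
      refine sum_le_sum_of_section (f := parent) (fun v hv => mul_nonneg (sqrtSlope_nonneg _ _)
        (sub_nonneg.2 (hδ _ (mem_image_of_mem _ hv)))) fun p hp => ?_
      obtain ⟨v, hv, rfl⟩ := mem_image.1 hp
      refine ⟨v, hv, rfl, mul_le_mul_of_nonneg_right ?_ (sub_nonneg.2 (hδ _ hp))⟩
      exact sqrtSlope_anti (h.pos hv) (le_push parent h.nonneg v) (le_push parent h'.nonneg v)
    have h2 : ∑ v, (len v : ℝ) * √(x v) - ∑ v, (len v : ℝ) * √(x' v)
        = ∑ v ∈ S, sqrtSlope (x v) (x' v) * (U' v - U v)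
          - ∑ v ∈ S, sqrtSlope (x v) (x' v) * (U₀' (parent v) - U₀ (parent v)) := by
      rw [← sum_sub_distrib, ← sum_sub_distrib, ← sum_subset (subset_univ S)]
      · refine sum_congr rfl fun v hv => ?_
        rw [← mul_sub, ← sqrtSlope_mul (h.nonneg v) (h'.nonneg v), hU v hv, hU' v hv]
        ring
      · intro v _ hv
        rw [hx v hv, hx' v hv, sub_self]
    rw [edgeSum, edgeSum]
    linarith

/-- Flows to the same set of nodes have the same support. -/
lemma edgeSum_support_eq (h : IsElectric T S x U V) (h' : IsElectric T S x' U' V') :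
    edgeSum (fun a _ => if a = 0 then 0 else 1) T x x
      = edgeSum (fun a _ => if a = 0 then 0 else 1) T x' x' := by
  induction T with
  | source => rfl
  | addLayer T n hn parent len ih =>
    obtain ⟨_, hx, U₀, h₀, hU⟩ := id h
    obtain ⟨_, hx', U₀', h₀', hU'⟩ := id h'
    rw [edgeSum, edgeSum, ih h₀ h₀']
    congr 1
    refine sum_congr rfl fun v _ => ?_
    by_cases hv : v ∈ S
    · rw [if_neg (h.pos hv).ne', if_neg (h'.pos hv).ne']
    · rw [if_pos (hx v hv), if_pos (hx' v hv)]

end IsElectric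

/-- Existence of electrical flows. -/
theorem exists_isElectric {m : ℕ} (T : LayeredTree m) (hT : T.PosLengths) (S : Finset (Fin m))
    (hS : S.Nonempty) (r : Fin m → ℝ) (hr : ∀ v, 0 ≤ r v) :
    ∃ x U V, IsElectric T S x U V ∧ ∀ v ∈ S, U v = r v * x v := by
  induction T with
  | source =>
    obtain ⟨v, hv⟩ := hS
    rw [Subsingleton.elim v 0] at hv
    exact ⟨fun _ => 1, r, r 0, ⟨hv, rfl, hr 0, rfl⟩, fun v _ => (mul_one _).symm⟩
  | @addLayer m₀ T n hn parent len ih =>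
    obtain ⟨hT, hlen⟩ := hT
    have hpos : ∀ v, 0 < (len v : ℝ) + r v := fun v => add_pos_of_pos_of_nonneg (hlen v) (hr v)
    -- The conductance seen from `p`: each edge in series with the resistance below it, the children
    -- in parallel. The flow on the parent layer is then solved with resistances `1 / g p`.
    set g : Fin m₀ → ℝ := fun p => ∑ v ∈ S with parent v = p, 1 / (len v + r v) with hg
    have hg0 : ∀ p, 0 ≤ g p := fun p => sum_nonneg fun v _ => (one_div_pos.2 (hpos v)).le
    have hgp : ∀ p ∈ S.image parent, 0 < g p := by
      intro p hp
      obtain ⟨v, hv, rfl⟩ := mem_image.1 hp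
      exact sum_pos (fun v _ => one_div_pos.2 (hpos v)) ⟨v, mem_filter.2 ⟨hv, rfl⟩⟩
    obtain ⟨x₀, U₀, V, h₀, hU₀⟩ := ih hT (S.image parent) (hS.image parent) (fun p => 1 / g p)
      fun p => one_div_nonneg.2 (hg0 p)
    set x : Fin n → ℝ := fun v => if v ∈ S then U₀ (parent v) / (len v + r v) else 0 with hx
    have hx0 : ∀ v ∉ S, x v = 0 := fun v hv => if_neg hv
    have hxS : ∀ v ∈ S, x v = U₀ (parent v) / (len v + r v) := fun v hv => if_pos hv
    have hpush : push parent x = x₀ := by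
      funext p
      by_cases hp : p ∈ S.image parent
      · have : push parent x p = U₀ p * g p := by
          rw [push_eq_sum parent hx0, hg, mul_sum]
          refine sum_congr rfl fun v hv => ?_
          obtain ⟨hvS, rfl⟩ := mem_filter.1 hv
          rw [hxS v hvS]; ring
        rw [this, hU₀ p hp]
        have := hgp p hp
        field_simp
      · rw [push_eq_zero parent hx0 hp, h₀.eq_zero hp]
    have hxpos : ∀ v ∈ S, 0 < x v := by
      intro v hv
      have hp := mem_image_of_mem parent hv
      rw [hxS v hv, hU₀ _ hp]
      exact div_pos (mul_pos (one_div_pos.2 (hgp _ hp)) (h₀.pos hp)) (hpos v)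
    refine ⟨x, fun v => r v * x v, V, ⟨fun v hv => ⟨hxpos v hv, mul_nonneg (hr v) (hxpos v hv).le⟩,
      hx0, U₀, hpush ▸ h₀, fun v hv => ?_⟩, fun v _ => rfl⟩
    have := hpos v
    have := hxS v hv
    field_simp at this
    linarith

/-! ### Loss of a leaf -/

/-- Used at the attachment point of a lost branch: `X` is the lost current, `z < X` that of the
remaining siblings, `a` that of one sibling, and `b`, `t` are the new currents of that sibling and
of the parent. The gap between the two slopes is what the square-root term gains per unit of
potential increase. -/
lemma sqrtSlope_sub_ge {a b z t X : ℝ} (ha : 0 < a) (haz : a ≤ z) (hzX : z < X) (hbt : b ≤ t)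
    (htX : t ≤ z + X) : 1 / (20 * √X) ≤ sqrtSlope a b - sqrtSlope (z + X) t := by
  have h1 : sqrtSlope z t ≤ sqrtSlope a b := sqrtSlope_anti ha haz hbt
  have hz : 0 < z := ha.trans_le haz
  have hX : 0 < X := hz.trans hzX
  refine le_trans ?_ (sub_le_sub_right h1 _)
  unfold sqrtSlope
  have hq := Real.sqrt_pos.2 hz
  have hξ := Real.sqrt_pos.2 hX
  have hs := Real.sqrt_pos.2 (add_pos hz hX)
  have hτ := Real.sqrt_nonneg t
  have hτs : √t ≤ √(z + X) := Real.sqrt_le_sqrt htX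
  have hqξ : √z ≤ √X := Real.sqrt_le_sqrt hzX.le
  have hs2 : √(z + X) ^ 2 = √z ^ 2 + √X ^ 2 := by
    rw [Real.sq_sqrt hz.le, Real.sq_sqrt hX.le, Real.sq_sqrt (add_pos hz hX).le]
  generalize √z = q at *
  generalize √X = ξ at *
  generalize √(z + X) = s at *
  generalize √t = τ at *
  -- Here `1.42` exceeds `√2`, and the final constant `20` exceeds `2.42 ^ 2 * 2 * 1.42`.
  have hsξ : s ≤ 1.42 * ξ := by
    by_contra! hlt
    nlinarith
  have hqs : q < s := by nlinarith
  have key : (q + τ) * (s + τ) ≤ 20 * ξ * (s - q) := by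
    have h2 : (q + τ) * (s + τ) ≤ (q + s) * (2 * s) := by
      have : q + τ ≤ q + s := by linarith
      have : s + τ ≤ 2 * s := by linarith
      gcongr
    refine h2.trans ?_
    have h3 : (q + s) * (2 * s) * (s + q) ≤ 20 * ξ * (s - q) * (s + q) := by
      have h4 : 20 * ξ * (s - q) * (s + q) = 20 * ξ * ξ ^ 2 := by
        have : (s - q) * (s + q) = ξ ^ 2 := by linarith [hs2, (by ring : (s - q) * (s + q) = s ^ 2 - q ^ 2)]
        rw [mul_assoc, this]
      rw [h4]
      have h5 : q + s ≤ 2.42 * ξ := by linarith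
      calc (q + s) * (2 * s) * (s + q) = (q + s) * (q + s) * (2 * s) := by ring
        _ ≤ (2.42 * ξ) * (2.42 * ξ) * (2 * (1.42 * ξ)) := by gcongr
        _ ≤ 20 * ξ * ξ ^ 2 := by nlinarith [pow_pos hξ 3]
    exact le_of_mul_le_mul_right h3 (by positivity)
  have h6 : 1 / (q + τ) - 1 / (s + τ) = (s - q) / ((q + τ) * (s + τ)) := by
    field_simp
    ring
  rw [h6, div_le_div_iff₀ (by positivity) (by positivity)]
  linarith

/-- If the potential above an edge increases while the resistance below stays the same, then the
potential below the edge and the flow through it increase. -/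
lemma potential_le_and_flow_le {l x U x' U' : ℝ} (hl : 0 < l) (hx : 0 < x) (hU : 0 ≤ U)
    (h : U + l * x ≤ U' + l * x') (hr : U' * x = U * x') : U ≤ U' ∧ x ≤ x' := by
  have h1 : x ≤ x' := by
    by_contra! hlt
    have : U' ≤ U := by
      by_contra! h2
      nlinarith [mul_le_mul_of_nonneg_left hlt.le hU, mul_lt_mul_of_pos_right h2 hx]
    nlinarith
  refine ⟨?_, h1⟩
  by_contra! h2
  nlinarith [mul_le_mul_of_nonneg_left h1 hU, mul_lt_mul_of_pos_right h2 hx]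

/-! ### Bookkeeping in one layer when a target is removed -/

section Layer

variable {m n : ℕ} {parent : Fin n → Fin m} {len : Fin n → ℝ≥0} {S : Finset (Fin n)} {u : Fin n}
  {x U x' U' : Fin n → ℝ} {U₀ U₀' : Fin m → ℝ}

lemma sum_erase_add_of_eq_zero {F : Fin n → ℝ} (hu : u ∈ S) (hF : ∀ v ∉ S, F v = 0) :
    ∑ v, F v = F u + ∑ v ∈ S.erase u, F v := by
  rw [add_sum_erase S F hu]
  exact (sum_subset (subset_univ S) fun v _ hv => hF v hv).symm

lemma layer_posPart_eq (hu : u ∈ S) (hx : ∀ v ∉ S, x v = 0) (hx' : ∀ v ∉ S.erase u, x' v = 0)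
    (hxu : 0 < x u) (hmono : ∀ v ∈ S.erase u, x v ≤ x' v) :
    ∑ v, (len v : ℝ) * max (x v - x' v) 0 = len u * x u := by
  rw [sum_erase_add_of_eq_zero hu, hx' u (by simp), sum_eq_zero, sub_zero, max_eq_left hxu.le,
    add_zero]
  · intro v hv
    rw [max_eq_right (sub_nonpos.2 (hmono v hv)), mul_zero]
  · intro v hv
    rw [hx v hv, hx' v (fun h => hv (mem_of_mem_erase h)), sub_self, max_self, mul_zero]

lemma layer_support_eq (hu : u ∈ S) (hx : ∀ v ∉ S, x v = 0) (hx' : ∀ v ∉ S.erase u, x' v = 0)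
    (hpos : ∀ v ∈ S, 0 < x v) (hpos' : ∀ v ∈ S.erase u, 0 < x' v) :
    ∑ v, (len v : ℝ) * (if x v = 0 then 0 else 1)
      = ∑ v, (len v : ℝ) * (if x' v = 0 then 0 else 1) + len u := by
  rw [sum_erase_add_of_eq_zero hu (fun v hv => by rw [if_pos (hx v hv), mul_zero]),
    sum_erase_add_of_eq_zero hu (fun v hv => by
      rw [if_pos (hx' v fun h => hv (mem_of_mem_erase h)), mul_zero]),
    if_neg (hpos u hu).ne', if_pos (hx' u (by simp))]
  have h1 : ∑ v ∈ S.erase u, (len v : ℝ) * (if x v = 0 then 0 else 1)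
      = ∑ v ∈ S.erase u, (len v : ℝ) * (if x' v = 0 then 0 else 1) := by
    refine sum_congr rfl fun v hv => ?_
    rw [if_neg (hpos v (mem_of_mem_erase hv)).ne', if_neg (hpos' v hv).ne']
  rw [h1]
  ring

lemma layer_sqrt_eq (hu : u ∈ S) (hx : ∀ v ∉ S, x v = 0) (hx' : ∀ v ∉ S.erase u, x' v = 0)
    (hpos : ∀ v ∈ S, 0 < x v) (hpos' : ∀ v ∈ S.erase u, 0 < x' v)
    (hU : ∀ v ∈ S, U₀ (parent v) = U v + len v * x v)
    (hU' : ∀ v ∈ S.erase u, U₀' (parent v) = U' v + len v * x' v) :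
    ∑ v, (len v : ℝ) * √(x' v) - ∑ v, (len v : ℝ) * √(x v) + len u * √(x u)
        + ∑ v ∈ S.erase u, sqrtSlope (x v) (x' v) * (U' v - U v)
      = ∑ v ∈ S.erase u, sqrtSlope (x v) (x' v) * (U₀' (parent v) - U₀ (parent v)) := by
  rw [sum_erase_add_of_eq_zero hu (F := fun v => (len v : ℝ) * √(x v))
      (fun v hv => by rw [hx v hv, Real.sqrt_zero, mul_zero]),
    sum_erase_add_of_eq_zero hu (F := fun v => (len v : ℝ) * √(x' v))
      (fun v hv => by rw [hx' v fun h => hv (mem_of_mem_erase h), Real.sqrt_zero, mul_zero]),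
    hx' u (by simp), Real.sqrt_zero]
  have : ∑ v ∈ S.erase u, sqrtSlope (x v) (x' v) * (U₀' (parent v) - U₀ (parent v))
      = ∑ v ∈ S.erase u, ((len v : ℝ) * √(x' v) - (len v : ℝ) * √(x v)
        + sqrtSlope (x v) (x' v) * (U' v - U v)) := by
    refine sum_congr rfl fun v hv => ?_
    have h1 := sqrtSlope_mul (hpos v (mem_of_mem_erase hv)).le (hpos' v hv).le
    rw [hU v (mem_of_mem_erase hv), hU' v hv, ← mul_sub]
    linear_combination (-(len v : ℝ)) * h1
  rw [this, sum_add_distrib, sum_sub_distrib]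
  ring

/-- The surviving children of `q` keep their resistances, so their old and new total currents are
both the same conductance times the old and new potential of `q`. -/
lemma layer_ratio_eq (hx' : ∀ v ∉ S.erase u, x' v = 0)
    (hU : ∀ v ∈ S, U₀ (parent v) = U v + len v * x v)
    (hU' : ∀ v ∈ S.erase u, U₀' (parent v) = U' v + len v * x' v)
    (hr : ∀ v ∈ S.erase u, U' v * x v = U v * x' v) (q : Fin m) :
    U₀' q * ∑ v ∈ S.erase u with parent v = q, x v = U₀ q * push parent x' q := by
  rw [push_eq_sum parent hx', mul_sum, mul_sum]
  refine sum_congr rfl fun v hv => ?_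
  obtain ⟨hvS, rfl⟩ := mem_filter.1 hv
  rw [hU v (mem_of_mem_erase hvS), hU' v hvS]
  linear_combination hr v hvS

lemma push_eq_erase_self (hu : u ∈ S) (hx : ∀ v ∉ S, x v = 0) :
    push parent x (parent u) = ∑ v ∈ S.erase u with parent v = parent u, x v + x u := by
  rw [push_eq_sum parent hx, filter_erase, 
    sum_erase_add _ _ (mem_filter.2 ⟨hu, rfl⟩ : u ∈ {v ∈ S | parent v = parent u})]

lemma push_eq_erase_of_ne (hx : ∀ v ∉ S, x v = 0) {q : Fin m} (hq : q ≠ parent u) :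
    push parent x q = ∑ v ∈ S.erase u with parent v = q, x v := by
  rw [push_eq_sum parent hx, filter_erase, erase_eq_of_notMem]
  exact fun h => hq (mem_filter.1 h).2.symm

end Layer

/-- What happens to the electrical flow when the node `u` is removed from the set of targets: here
`W` is the length of the branch that is lost and `δ` the increase of the potential of the node at
which it was attached. -/
theorem exists_erase_bound {m : ℕ} {T : LayeredTree m} (hT : T.PosLengths) {S : Finset (Fin m)}
    {u : Fin m} (hu : u ∈ S) {x U x' U' : Fin m → ℝ} {V V' : ℝ} (h : IsElectric T S x U V)
    (h' : IsElectric T (S.erase u) x' U' V') (hr : ∀ v ∈ S.erase u, U' v * x v = U v * x' v) :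
    (∀ v ∈ S.erase u, U v ≤ U' v ∧ x v ≤ x' v) ∧ ∃ W δ G : ℝ, 0 ≤ W ∧ 0 ≤ δ ∧
      edgeSum (fun a b => max (a - b) 0) T x x' ≤ W * x u + δ ∧
      x u * (δ + W * x u + U u) ≤ V' - V ∧
      edgeSum (fun a _ => if a = 0 then 0 else 1) T x x
        = edgeSum (fun a _ => if a = 0 then 0 else 1) T x' x' + W ∧
      G = edgeSum (fun a _ => √a) T x' x' - edgeSum (fun a _ => √a) T x x + W * √(x u)
        + ∑ v ∈ S.erase u, sqrtSlope (x v) (x' v) * (U' v - U v) ∧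
      0 ≤ G ∧ (δ ≤ U u + W * x u ∨ δ * (1 / (20 * √(x u))) ≤ G) := by
  induction T with
  | source => exact absurd (Subsingleton.elim u 0 ▸ h'.1) (by simp)
  | addLayer T n hn parent len ih =>
    obtain ⟨hT, hlen⟩ := hT
    have hpos : ∀ v ∈ S, 0 < x v := fun v hv => h.pos hv
    have hpos' : ∀ v ∈ S.erase u, 0 < x' v := fun v hv => h'.pos hv
    have hxn := h.nonneg
    have hxn' := h'.nonneg
    obtain ⟨hS, hx, U₀, h₀, hU⟩ := h
    obtain ⟨hS', hx', U₀', h₀', hU'⟩ := h'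
    have hratio := layer_ratio_eq hx' hU hU' hr
    have hterm : (∀ v ∈ S.erase u, U₀ (parent v) ≤ U₀' (parent v)) →
        ∀ v ∈ S.erase u, U v ≤ U' v ∧ x v ≤ x' v := by
      intro hpar v hv
      have h1 := hpar v hv
      have hvS := mem_of_mem_erase hv
      rw [hU v hvS, hU' v hv] at h1
      exact potential_le_and_flow_le (hlen v) (hpos v hvS) (hS v hvS).2 h1 (hr v hv)
    have hsqrt := layer_sqrt_eq (parent := parent) hu hx hx' hpos hpos' hU hU'
    have hsupp := layer_support_eq (len := len) hu hx hx' hpos hpos'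
    have hpu := push_eq_erase_self (parent := parent) hu hx
    have hUu := hU u hu
    have hX := hpos u hu
    have hl : (0 : ℝ) ≤ len u := (len u).2
    by_cases hc : ∃ c ∈ S.erase u, parent c = parent u
    -- A sibling survives: the lost branch is the single edge above `u`, attached at its parent `p`.
    -- Above it, the set of targets is unchanged and only the resistance at `p` rises.
    · obtain ⟨c, hcS, hcu⟩ := hc
      have himg : (S.erase u).image parent = S.image parent := by
        refine subset_antisymm (image_subset_image (erase_subset _ _)) fun q hq => ?_
        obtain ⟨v, hv, rfl⟩ := mem_image.1 hq
        by_cases hvu : v = u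
        · rw [hvu, ← hcu]; exact mem_image_of_mem _ hcS
        · exact mem_image_of_mem _ (mem_erase.2 ⟨hvu, hv⟩)
      rw [himg] at h₀'
      have hup : parent u ∈ S.image parent := mem_image_of_mem _ hu
      set p := parent u with hp
      set z := ∑ v ∈ S.erase u with parent v = p, x v with hz
      have hcz : x c ≤ z := single_le_sum (f := x) (fun v _ => hxn v) (mem_filter.2 ⟨hcS, hcu⟩)
      have hxc := hpos c (mem_of_mem_erase hcS)
      have hzpos : 0 < z := hxc.trans_le hcz
      have hratne : ∀ q, q ≠ p → U₀' q * push parent x q = U₀ q * push parent x' q := by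
        intro q hq
        rw [push_eq_erase_of_ne hx hq, hratio]
      have hU₀n : ∀ q ∈ S.image parent, 0 < U₀ q := by
        intro q hq
        obtain ⟨v, hv, rfl⟩ := mem_image.1 hq
        rw [hU v hv]
        have := hpos v hv
        have h1 : (0 : ℝ) < len v := hlen v
        have := (hS v hv).2
        positivity
      have hM : ∀ q ∈ S.image parent, U₀ q * push parent x' q ≤ U₀' q * push parent x q := by
        intro q hq
        by_cases hqp : q = p
        · rw [hqp, ← hratio, hpu]
          have := h₀'.potential_nonneg hup
          gcongr
          linarith
        · exact (hratne q hqp).ge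
      have hδ := h₀.potential_mono h₀' hM
      have hflow : ∀ q ∈ S.image parent, q ≠ p → push parent x q ≤ push parent x' q := by
        intro q hq hqp
        have h1 := hratne q hqp
        have h2 := hδ q hq
        have h3 := h₀.pos hq
        by_contra! hlt
        nlinarith [mul_lt_mul_of_pos_left hlt (hU₀n q hq), mul_le_mul_of_nonneg_right h2 h3.le]
      -- Every other parent gains current and the total is one, so `p` loses.
      have hxp' : push parent x' p ≤ push parent x p := by
        have h1 := h₀.sum_eq_one
        have h2 := h₀'.sum_eq_one
        rw [← add_sum_erase univ _ (mem_univ p)] at h1 h2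
        have h3 : ∑ q ∈ univ.erase p, push parent x q ≤ ∑ q ∈ univ.erase p, push parent x' q := by
          refine sum_le_sum fun q hq => ?_
          by_cases hqS : q ∈ S.image parent
          · exact hflow q hqS (ne_of_mem_erase hq)
          · rw [h₀.eq_zero hqS, h₀'.eq_zero hqS]
        linarith
      have ht := hterm fun v hv => hδ _ (mem_image_of_mem _ (mem_of_mem_erase hv))
      -- Pairing each flow with the other gives the same mixed energy, so `V' - V` reduces to
      -- boundary terms; these vanish except at `p`, where `x u * U₀' p` remains.
      have hpot := h₀.edgeSum_mul_add (fun v hv => h₀'.eq_zero hv) h₀'.sum_eq_one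
      have hpot' := h₀'.edgeSum_mul_add (fun v hv => h₀.eq_zero hv) h₀.sum_eq_one
      have hpos_up := h₀.edgeSum_posPart_le h₀' hM
      have hP := h₀.edgeSum_sqrt_sub_le h₀' hM
      have hδp := hδ p hup
      refine ⟨ht, len u, U₀' p - U₀ p, _, hl, sub_nonneg.2 hδp, ?_, ?_, ?_, rfl, ?_⟩
      · rw [edgeSum, layer_posPart_eq hu hx hx' hX fun v hv => (ht v hv).2, add_comm]
        refine add_le_add_right (hpos_up.trans ?_) _
        calc ∑ q ∈ S.image parent with push parent x' q < push parent x q, (U₀' q - U₀ q)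
            ≤ ∑ q ∈ {p}, (U₀' q - U₀ q) := by
              refine sum_le_sum_of_subset_of_nonneg ?_ fun q hq _ => ?_
              · intro q hq
                obtain ⟨hqS, hlt⟩ := mem_filter.1 hq
                rw [mem_singleton]
                by_contra hqp
                exact absurd hlt (not_lt.2 (hflow q hqS hqp))
              · rw [mem_singleton.1 hq]; exact sub_nonneg.2 hδp
          _ = U₀' p - U₀ p := sum_singleton _ _
      · have hcomm : edgeSum (fun a b => a * b) T (push parent x') (push parent x)
            = edgeSum (fun a b => a * b) T (push parent x) (push parent x') := by
          rw [edgeSum_swap]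
          simp only [mul_comm]
        have hdiff : V' - V = ∑ q, (push parent x q * U₀' q - push parent x' q * U₀ q) := by
          rw [sum_sub_distrib]; linarith
        rw [hdiff, sum_eq_single p]
        · have := hratio p
          rw [hpu]
          apply le_of_eq
          linear_combination (-x u) * hUu - this
        · intro q _ hqp
          linear_combination hratne q hqp
        · simp
      · rw [edgeSum, edgeSum, h₀.edgeSum_support_eq h₀', hsupp]
        ring
      -- The telescoping inequality with its slack at `p` retained: the child chosen there is `c`,
      -- whose slope exceeds that of `p`.
      · have hgain : (U₀' p - U₀ p) * (sqrtSlope (x c) (x' c)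
              - sqrtSlope (push parent x p) (push parent x' p))
            + ∑ q ∈ S.image parent, sqrtSlope (push parent x q) (push parent x' q) * (U₀' q - U₀ q)
            ≤ ∑ v ∈ S.erase u, sqrtSlope (x v) (x' v) * (U₀' (parent v) - U₀ (parent v)) := by
          have h1 : (U₀' p - U₀ p) * (sqrtSlope (x c) (x' c)
              - sqrtSlope (push parent x p) (push parent x' p))
              = ∑ q ∈ S.image parent, if q = p then (U₀' p - U₀ p) * (sqrtSlope (x c) (x' c)
              - sqrtSlope (push parent x p) (push parent x' p)) else 0 := by
            rw [sum_ite_eq' _ p, if_pos hup]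
          rw [h1, ← sum_add_distrib]
          refine sum_le_sum_of_section (f := parent) (fun v hv => mul_nonneg (sqrtSlope_nonneg _ _)
            (sub_nonneg.2 (hδ _ (mem_image_of_mem _ (mem_of_mem_erase hv))))) fun q hq => ?_
          by_cases hqp : q = p
          · refine ⟨c, hcS, hcu.trans hqp.symm, ?_⟩
            rw [if_pos hqp, hcu, hqp]
            apply le_of_eq
            ring
          · have hq' := hq
            rw [← himg] at hq'
            obtain ⟨v, hv, rfl⟩ := mem_image.1 hq'
            refine ⟨v, hv, rfl, ?_⟩
            rw [if_neg hqp, zero_add]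
            refine mul_le_mul_of_nonneg_right ?_ (sub_nonneg.2 (hδ _ hq))
            exact sqrtSlope_anti (hpos v (mem_of_mem_erase hv)) (le_push parent hxn v)
              (le_push parent hxn' v)
        have hG : (U₀' p - U₀ p) * (sqrtSlope (x c) (x' c)
              - sqrtSlope (push parent x p) (push parent x' p))
            ≤ edgeSum (fun a _ => √a) (addLayer T n hn parent len) x' x'
              - edgeSum (fun a _ => √a) (addLayer T n hn parent len) x x + len u * √(x u)
              + ∑ v ∈ S.erase u, sqrtSlope (x v) (x' v) * (U' v - U v) := by
          rw [edgeSum, edgeSum]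
          linarith
        have hxcp' : x' c ≤ push parent x' p := hcu ▸ le_push parent hxn' c
        refine ⟨le_trans (mul_nonneg (sub_nonneg.2 hδp) (sub_nonneg.2 ?_)) hG, ?_⟩
        · exact sqrtSlope_anti hxc (hcu ▸ le_push parent hxn c) hxcp'
        -- If the siblings carry at least `x u`, then `U₀' p * z = U₀ p * x' ≤ 2 * U₀ p * z`, with
        -- `x'` the new current through `p`, so the potential at `p` at most doubles. Otherwise the
        -- slack of `hgain` pays.
        · by_cases hzX : x u ≤ z
          · left
            rw [← hUu]
            have h1 := hratio p
            have h2 := hU₀n p hup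
            by_contra! hlt
            nlinarith
          · right
            refine le_trans (mul_le_mul_of_nonneg_left ?_ (sub_nonneg.2 hδp)) hG
            rw [hpu]
            exact sqrtSlope_sub_ge hxc hcz (not_le.1 hzX) hxcp' (hpu ▸ hxp')
    -- Without a surviving sibling the parent of `u` is lost too; the branch continues upwards with
    -- the same current `x u`, and `W` grows by `len u`.
    · push Not at hc
      have himg : (S.erase u).image parent = (S.image parent).erase (parent u) := by
        ext q
        simp only [mem_image, mem_erase]
        constructor
        · rintro ⟨v, ⟨hvu, hv⟩, rfl⟩
          exact ⟨hc v (mem_erase.2 ⟨hvu, hv⟩), v, hv, rfl⟩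
        · rintro ⟨hq, v, hv, rfl⟩
          exact ⟨v, ⟨fun hvu => hq (hvu ▸ rfl), hv⟩, rfl⟩
      rw [himg] at h₀'
      have hpu' : push parent x (parent u) = x u := by
        rw [hpu, filter_false_of_mem hc, sum_empty, zero_add]
      obtain ⟨hδ, W, δ, G, hW, hδ0, hup, hV, hsup, hG, hG0, hor⟩ :=
        ih hT (mem_image_of_mem _ hu) h₀ h₀' fun q hq => by
          rw [push_eq_erase_of_ne hx (ne_of_mem_erase hq), hratio]
      have hmem : ∀ v ∈ S.erase u, parent v ∈ (S.image parent).erase (parent u) := fun v hv =>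
        himg ▸ mem_image_of_mem _ hv
      have ht := hterm fun v hv => (hδ _ (hmem v hv)).1
      rw [hpu'] at hup hV hG hor
      have hcmp : ∑ q ∈ (S.image parent).erase (parent u),
            sqrtSlope (push parent x q) (push parent x' q) * (U₀' q - U₀ q)
          ≤ ∑ v ∈ S.erase u, sqrtSlope (x v) (x' v) * (U₀' (parent v) - U₀ (parent v)) := by
        refine sum_le_sum_of_section (f := parent) (fun v hv => mul_nonneg (sqrtSlope_nonneg _ _)
          (sub_nonneg.2 (hδ _ (hmem v hv)).1)) fun q hq => ?_
        have hq' := hq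
        rw [← himg] at hq'
        obtain ⟨v, hv, rfl⟩ := mem_image.1 hq'
        refine ⟨v, hv, rfl, mul_le_mul_of_nonneg_right ?_ (sub_nonneg.2 (hδ _ hq).1)⟩
        exact sqrtSlope_anti (hpos v (mem_of_mem_erase hv)) (le_push parent hxn v)
          (le_push parent hxn' v)
      have hGle : G ≤ edgeSum (fun a _ => √a) (addLayer T n hn parent len) x' x'
          - edgeSum (fun a _ => √a) (addLayer T n hn parent len) x x + (W + len u) * √(x u)
          + ∑ v ∈ S.erase u, sqrtSlope (x v) (x' v) * (U' v - U v) := by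
        rw [edgeSum, edgeSum]
        linarith
      refine ⟨ht, W + len u, δ, _, add_nonneg hW hl, hδ0, ?_, ?_, ?_, rfl, hG0.trans hGle, ?_⟩
      · rw [edgeSum, layer_posPart_eq hu hx hx' hX fun v hv => (ht v hv).2]
        linarith
      · rw [hUu] at hV
        linarith
      · rw [edgeSum, edgeSum, hsup, hsupp]
        ring
      · rcases hor with hor | hor
        · left
          rw [hUu] at hor
          linarith
        · exact Or.inr (hor.trans hGle)

/-! ### The potential function -/

/-- The potential function, for a flow `x` with potential `V` at the source. -/
noncomputable def pot (κ : ℝ) {m : ℕ} (T : LayeredTree m) (x : Fin m → ℝ) (V : ℝ) : ℝ :=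
  edgeSum (fun a _ => √a) T x x / √κ
    + (2 * T.length - edgeSum (fun a _ => if a = 0 then 0 else 1) T x x) / κ + κ * V

/-- Here `k = √κ` and `ξ = √X` for the lost current `X`. The second term of the potential function
compensates for the loss of `W * ξ / k` in the first; for the rise `δ`, large currents are paid by
the resistance term and small ones by `G`. -/
lemma erase_bound_aux {k ξ W δ G d D : ℝ} (hk : 0 < k) (hξ : 0 < ξ) (hW : 0 ≤ W) (hδ : 0 ≤ δ)
    (hG : 0 ≤ G) (hor : δ ≤ W * ξ ^ 2 ∨ δ * (1 / (20 * ξ)) ≤ G)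
    (hd : ξ ^ 2 * (δ + W * ξ ^ 2) ≤ d) (hD : D = (G - W * ξ) / k + W / k ^ 2 + k ^ 2 * d) :
    W * ξ ^ 2 + δ ≤ 5 * D := by
  -- With `σ = ξ * k` and `w = W / k ^ 2` the parameter `k` disappears, and what matters is that `1
  -- - σ + σ ^ 4 ≥ σ ^ 2 / 2` and `1 / (20 * σ) + σ ^ 2 ≥ 1 / 5`.
  obtain ⟨σ, rfl⟩ : ∃ σ, ξ = σ / k := ⟨ξ * k, by field_simp⟩
  obtain ⟨w, rfl⟩ : ∃ w, W = w * k ^ 2 := ⟨W / k ^ 2, by field_simp⟩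
  have hσ : 0 < σ := by
    have := mul_pos hξ hk
    rwa [div_mul_cancel₀ _ hk.ne'] at this
  have hw : 0 ≤ w := nonneg_of_mul_nonneg_left hW (by positivity)
  have e1 : w * k ^ 2 * (σ / k) ^ 2 = w * σ ^ 2 := by field_simp
  rw [e1] at hor hd ⊢
  have hd' : σ ^ 2 * (δ + w * σ ^ 2) ≤ k ^ 2 * d := by
    have := mul_le_mul_of_nonneg_left hd (sq_nonneg k)
    refine le_trans (le_of_eq ?_) this
    field_simp
  have hD' : D = G / k - w * σ + w + k ^ 2 * d := by
    rw [hD]; field_simp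
  have p1 : σ ^ 2 ≤ 2 * (1 - σ + σ ^ 4) := by
    nlinarith [sq_nonneg (σ ^ 2 - 1 / 2), sq_nonneg (σ - 1)]
  have hwp := mul_le_mul_of_nonneg_left p1 hw
  have hw0 : 0 ≤ w * σ ^ 2 := by positivity
  have hGk : 0 ≤ G / k := by positivity
  rcases hor with hor | hor
  · have : 0 ≤ σ ^ 2 * δ := by positivity
    nlinarith
  · have h2 : δ ≤ 5 * (G / k + σ ^ 2 * δ) := by
      have h3 : δ * (1 / (20 * σ)) ≤ G / k := by
        rw [le_div_iff₀ hk]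
        refine le_trans (le_of_eq ?_) hor
        field_simp
      have h4 : 1 ≤ 5 * (1 / (20 * σ) + σ ^ 2) := by
        rw [← sub_nonneg]
        have : 5 * (1 / (20 * σ) + σ ^ 2) - 1 = (1 + 20 * σ ^ 3 - 4 * σ) / (4 * σ) := by
          field_simp
          ring
        rw [this]
        refine div_nonneg ?_ (by positivity)
        nlinarith [mul_nonneg hσ.le (sq_nonneg (σ - 1 / 4)), sq_nonneg (σ - 1 / 4)]
      nlinarith [mul_le_mul_of_nonneg_left h4 hδ]
    nlinarith

lemma edgeSum_posPart_triangle {m : ℕ} (T : LayeredTree m) (x y z : Fin m → ℝ) :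
    edgeSum (fun a b => max (a - b) 0) T x z
      ≤ edgeSum (fun a b => max (a - b) 0) T x y + edgeSum (fun a b => max (a - b) 0) T y z := by
  induction T with
  | source => simp [edgeSum]
  | addLayer T n hn parent len ih =>
    have h1 := ih (push parent x) (push parent y) (push parent z)
    have h2 : ∑ v, (len v : ℝ) * max (x v - z v) 0
        ≤ ∑ v, (len v : ℝ) * max (x v - y v) 0 + ∑ v, (len v : ℝ) * max (y v - z v) 0 := by
      rw [← sum_add_distrib]
      refine sum_le_sum fun v _ => ?_
      rw [← mul_add]
      refine mul_le_mul_of_nonneg_left (max_le ?_ ?_) (len v).2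
      · linarith [le_max_left (x v - y v) 0, le_max_left (y v - z v) 0]
      · positivity
    rw [edgeSum, edgeSum, edgeSum]
    linarith

lemma edgeSum_posPart_self {m : ℕ} (T : LayeredTree m) (x : Fin m → ℝ) :
    edgeSum (fun a b => max (a - b) 0) T x x = 0 := by
  induction T with
  | source => rfl
  | addLayer T n hn parent len ih => simp [edgeSum, ih]

/-- The upward movement caused by the loss of one target is bounded by the increase of the
potential function. -/
lemma posPart_le_of_erase {κ : ℝ} (hκ : 0 < κ) {m : ℕ} {T : LayeredTree m} (hT : T.PosLengths)
    {S : Finset (Fin m)} {u : Fin m} (hu : u ∈ S) {x U x' U' : Fin m → ℝ} {V V' : ℝ}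
    (h : IsElectric T S x U V) (hU : ∀ v ∈ S, U v = 0)
    (h' : IsElectric T (S.erase u) x' U' V') (hU' : ∀ v ∈ S.erase u, U' v = 0) :
    edgeSum (fun a b => max (a - b) 0) T x x' ≤ 5 * (pot κ T x' V' - pot κ T x V) := by
  obtain ⟨-, W, δ, G, hW, hδ, hup, hV, hsupp, hG, hG0, hor⟩ :=
    exists_erase_bound hT hu h h' fun v hv => by
      rw [hU v (mem_of_mem_erase hv), hU' v hv, zero_mul, zero_mul]
  have hX := h.pos hu
  have hsq : √(x u) ^ 2 = x u := Real.sq_sqrt hX.le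
  have hκs : √κ ^ 2 = κ := Real.sq_sqrt hκ.le
  rw [hU u hu, zero_add] at hor
  rw [hU u hu, add_zero] at hV
  rw [sum_eq_zero, add_zero] at hG
  · refine hup.trans ?_
    have := erase_bound_aux (k := √κ) (ξ := √(x u)) (W := W) (δ := δ) (G := G) (d := V' - V)
      (D := pot κ T x' V' - pot κ T x V) (Real.sqrt_pos.2 hκ) (Real.sqrt_pos.2 hX) hW hδ hG0
      (by rwa [hsq]) (by rw [hsq]; linarith) ?_
    · rwa [hsq] at this
    · rw [pot, pot, hsupp, hG, hκs]
      ring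
  · intro v hv
    rw [hU v (mem_of_mem_erase hv), hU' v hv, sub_self, mul_zero]

/-- The upward movement caused by the loss of several targets. -/
lemma exists_isElectric_subset {κ : ℝ} (hκ : 0 < κ) {m : ℕ} {T : LayeredTree m}
    (hT : T.PosLengths) {S' : Finset (Fin m)} (hS' : S'.Nonempty) (S : Finset (Fin m))
    (hSS : S' ⊆ S) {x U : Fin m → ℝ} {V : ℝ} (h : IsElectric T S x U V) (hU : ∀ v ∈ S, U v = 0) :
    ∃ x' U' V', IsElectric T S' x' U' V' ∧ (∀ v ∈ S', U' v = 0) ∧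
      edgeSum (fun a b => max (a - b) 0) T x x' ≤ 5 * (pot κ T x' V' - pot κ T x V) := by
  induction S using Finset.strongInduction generalizing x U V with
  | H S ih =>
    rcases hSS.eq_or_ssubset with rfl | hss
    · exact ⟨x, U, V, h, hU, by rw [edgeSum_posPart_self]; simp⟩
    · obtain ⟨u, hu, huS⟩ := exists_of_ssubset hss
      have hsub : S' ⊆ S.erase u := fun v hv => mem_erase.2 ⟨fun e => huS (e ▸ hv), hSS hv⟩
      obtain ⟨y, Y, B, hy, hY⟩ := exists_isElectric T hT (S.erase u) (hS'.mono hsub)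
        (fun _ => 0) fun _ => le_rfl
      simp only [zero_mul] at hY
      obtain ⟨x', U', V', h', hU', hle⟩ := ih (S.erase u) (erase_ssubset hu) hsub hy hY
      refine ⟨x', U', V', h', hU', (edgeSum_posPart_triangle T x y x').trans ?_⟩
      linarith [posPart_le_of_erase hκ hT hu h hU hy hY]

/-- The upward movement and the forward movement caused by a new layer, when each node has
a child in the new layer or is not a target. -/
lemma posPart_add_le_of_addLayer {κ : ℝ} (hκ : 0 < κ) {m n : ℕ} {T : LayeredTree m} (hn : 0 < n)
    {parent : Fin n → Fin m} {len : Fin n → ℝ≥0} {x U : Fin m → ℝ} {x' U' : Fin n → ℝ} {V V' : ℝ}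
    (h : IsElectric T (univ.image parent) x U V) (hU : ∀ v ∈ univ.image parent, U v = 0)
    (h' : IsElectric (addLayer T n hn parent len) univ x' U' V') (hU' : ∀ v, U' v = 0) :
    edgeSum (fun a b => max (a - b) 0) T x (push parent x') + ∑ v, (len v : ℝ) * x' v
      ≤ pot κ (addLayer T n hn parent len) x' V' - pot κ T x V := by
  have hpos : ∀ v, 0 < x' v := fun v => h'.pos (mem_univ v)
  obtain ⟨-, -, U₀, h₀, hU₀⟩ := h'
  replace hU₀ : ∀ v, U₀ (parent v) = len v * x' v := fun v => by
    rw [hU₀ v (mem_univ v), hU' v, zero_add]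
  have hM : ∀ p ∈ univ.image parent, U p * push parent x' p ≤ U₀ p * x p := fun p hp => by
    rw [hU p hp, zero_mul]
    exact mul_nonneg (h₀.potential_nonneg hp) (h.nonneg p)
  -- The old targets were grounded and now have potential `len v * x' v` for any child `v`, which
  -- bounds the upward movement.
  have hup : edgeSum (fun a b => max (a - b) 0) T x (push parent x')
      ≤ ∑ v, (len v : ℝ) * x' v := by
    refine (h.edgeSum_posPart_le h₀ hM).trans (sum_le_sum_of_section (f := parent)
      (fun v _ => mul_nonneg (len v).2 (hpos v).le) fun p hp => ?_)
    have hpi := (mem_filter.1 hp).1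
    obtain ⟨v, hv, rfl⟩ := mem_image.1 hpi
    exact ⟨v, hv, rfl, by rw [hU _ hpi, hU₀, sub_zero]⟩
  have hP : edgeSum (fun a _ => √a) T x x
        - edgeSum (fun a _ => √a) T (push parent x') (push parent x')
      ≤ ∑ v, (len v : ℝ) * √(x' v) := by
    refine (h.edgeSum_sqrt_sub_le h₀ hM).trans (sum_le_sum_of_section (f := parent)
      (fun v _ => mul_nonneg (len v).2 (Real.sqrt_nonneg _)) fun p hp => ?_)
    obtain ⟨v, hv, rfl⟩ := mem_image.1 hp
    refine ⟨v, hv, rfl, ?_⟩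
    rw [hU _ hp, hU₀, sub_zero]
    have h1 : √(x' v) ≤ √(push parent x' (parent v)) :=
      Real.sqrt_le_sqrt (le_push parent (fun v => (hpos v).le) v)
    have h2 := Real.sqrt_pos.2 (hpos v)
    have h3 : sqrtSlope (x (parent v)) (push parent x' (parent v)) * √(x' v) ≤ 1 := by
      have := Real.sqrt_nonneg (x (parent v))
      rw [sqrtSlope, one_div_mul_eq_div, div_le_one (by linarith)]
      linarith
    calc sqrtSlope (x (parent v)) (push parent x' (parent v)) * (len v * x' v)
        = len v * √(x' v)
          * (sqrtSlope (x (parent v)) (push parent x' (parent v)) * √(x' v)) := by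
          linear_combination (-(sqrtSlope (x (parent v)) (push parent x' (parent v)) * len v))
            * Real.mul_self_sqrt (hpos v).le
      _ ≤ len v * √(x' v) := mul_le_of_le_one_right (mul_nonneg (len v).2 h2.le) h3
  have hVV : ∑ v, (len v : ℝ) * x' v ^ 2 ≤ V' - V := by
    have e1 := h.edgeSum_mul_add (fun v hv => h₀.eq_zero hv) h₀.sum_eq_one
    have e2 := h.edgeSum_mul_add (fun v hv => h.eq_zero hv) h.sum_eq_one
    have e3 := h₀.edgeSum_mul_add (fun v hv => h₀.eq_zero hv) h₀.sum_eq_one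
    rw [sum_push_mul] at e3
    have hz : ∀ y : Fin m → ℝ, (∀ v ∉ univ.image parent, y v = 0) → ∑ v, y v * U v = 0 := by
      refine fun y hy => sum_eq_zero fun v _ => ?_
      by_cases hv : v ∈ univ.image parent
      · rw [hU v hv, mul_zero]
      · rw [hy v hv, zero_mul]
    rw [hz _ fun v hv => h₀.eq_zero hv, add_zero] at e1
    rw [hz _ fun v hv => h.eq_zero hv, add_zero, edgeSum_diag,
      edgeSum_left (fun a => a * a) T x x (push parent x')] at e2
    rw [edgeSum_diag, edgeSum_left (fun a => a * a) T _ _ x, edgeSum_swap] at e3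
    -- Since the mixed energy and the energy of `x` both equal `V`, this shows that the energy of
    -- the pushed flow is at least `V` (Thomson's principle); the new edges add the rest.
    have e4 : 2 * edgeSum (fun a b => a * b) T x (push parent x')
        ≤ edgeSum (fun a _ => a * a) T x (push parent x')
          + edgeSum (fun _ b => b * b) T x (push parent x') := by
      rw [← edgeSum_const_mul, ← edgeSum_add]
      exact edgeSum_mono (fun a b _ _ => by nlinarith [sq_nonneg (a - b)]) T h.nonneg h₀.nonneg
    have e5 : ∑ v, (len v : ℝ) * x' v ^ 2 = ∑ v, x' v * U₀ (parent v) :=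
      sum_congr rfl fun v _ => by rw [hU₀]; ring
    have e1' : edgeSum (fun a b => a * b) T x (push parent x') = V := e1
    linarith
  have hsupp := h.edgeSum_support_eq h₀
  have hone : ∑ v, (len v : ℝ) * (if x' v = 0 then 0 else 1) = ∑ v, (len v : ℝ) :=
    sum_congr rfl fun v _ => by rw [if_neg (hpos v).ne', mul_one]
  have hamgm : 2 * ∑ v, (len v : ℝ) * x' v
      ≤ (∑ v, (len v : ℝ)) / κ + κ * ∑ v, (len v : ℝ) * x' v ^ 2 := by
    rw [mul_sum, mul_sum, sum_div, ← sum_add_distrib]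
    refine sum_le_sum fun v _ => ?_
    have h1 : 2 * x' v ≤ 1 / κ + κ * x' v ^ 2 := by
      have : 1 / κ + κ * x' v ^ 2 - 2 * x' v = κ * (x' v - 1 / κ) ^ 2 := by field_simp; ring
      nlinarith [mul_nonneg hκ.le (sq_nonneg (x' v - 1 / κ))]
    calc 2 * ((len v : ℝ) * x' v) = len v * (2 * x' v) := by ring
      _ ≤ len v * (1 / κ + κ * x' v ^ 2) := mul_le_mul_of_nonneg_left h1 (len v).2
      _ = _ := by ring
  have hpot : pot κ (addLayer T n hn parent len) x' V' - pot κ T x V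
      = (∑ v, (len v : ℝ) * √(x' v) - (edgeSum (fun a _ => √a) T x x
        - edgeSum (fun a _ => √a) T (push parent x') (push parent x'))) / √κ
        + (∑ v, (len v : ℝ)) / κ + κ * (V' - V) := by
    rw [pot, pot, edgeSum, edgeSum, hsupp, hone, length]
    ring
  have h6 := div_nonneg (sub_nonneg.2 hP) (Real.sqrt_nonneg κ)
  have h7 := mul_le_mul_of_nonneg_left hVV hκ.le
  rw [hpot]
  linarith

/-- The upward movement caused by a new layer. -/
theorem posPart_le_of_addLayer {κ : ℝ} (hκ : 0 < κ) {m n : ℕ} {T : LayeredTree m}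
    (hT : T.PosLengths) (hn : 0 < n) {parent : Fin n → Fin m} {len : Fin n → ℝ≥0}
    {x U : Fin m → ℝ} {x' U' : Fin n → ℝ} {V V' : ℝ}
    (h : IsElectric T univ x U V) (hU : ∀ v, U v = 0)
    (h' : IsElectric (addLayer T n hn parent len) univ x' U' V') (hU' : ∀ v, U' v = 0) :
    edgeSum (fun a b => max (a - b) 0) T x (push parent x')
      ≤ 5 * (pot κ (addLayer T n hn parent len) x' V' - pot κ T x V) := by
  have : Nonempty (Fin n) := ⟨⟨0, hn⟩⟩
  obtain ⟨y, Y, B, hy, hY, hle⟩ := exists_isElectric_subset hκ hT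
    (univ_nonempty.image parent) univ (subset_univ _) h fun v _ => hU v
  have h1 := posPart_add_le_of_addLayer hκ hn hy hY h' hU'
  have h2 : 0 ≤ ∑ v, (len v : ℝ) * x' v :=
    sum_nonneg fun v _ => mul_nonneg (len v).2 (h'.nonneg v)
  have h3 : 0 ≤ edgeSum (fun a b => max (a - b) 0) T y (push parent x') :=
    edgeSum_nonneg (fun _ _ => le_max_right _ _) T _ _
  linarith [edgeSum_posPart_triangle T x y (push parent x')]

open Filter Topology

/-! ### Fractional strategies -/

/-- The tree with all edge lengths increased by `ε`. -/
def stretch (ε : ℝ≥0) : {m : ℕ} → LayeredTree m → LayeredTree m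
  | _, source => source
  | _, addLayer T n hn parent len => addLayer (T.stretch ε) n hn parent fun v => len v + ε

/-- The distance travelled by a fractional strategy `X`, which assigns to each layered tree a mass
distribution on the last layer. -/
noncomputable def fracTravelled (X : (m : ℕ) → LayeredTree m → Fin m → ℝ) :
    {m : ℕ} → LayeredTree m → ℝ
  | _, source => 0
  | _, addLayer (m := m) T n hn parent len =>
      fracTravelled X T
        + edgeSum (fun a b => |a - b|) T (X m T) (push parent (X n (addLayer T n hn parent len)))
        + ∑ v, (len v : ℝ) * X n (addLayer T n hn parent len) v

/-- The cost of a fractional strategy. -/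
noncomputable def fracCost (X : (m : ℕ) → LayeredTree m → Fin m → ℝ) {m : ℕ} (T : LayeredTree m)
    (t : Fin m) : ℝ :=
  fracTravelled X T + edgeSum (fun a b => |a - b|) T (X m T) (Pi.single t 1)

lemma posLengths_stretch {ε : ℝ≥0} (hε : 0 < ε) {m : ℕ} (T : LayeredTree m) :
    (T.stretch ε).PosLengths := by
  induction T with
  | source => trivial
  | addLayer T n hn parent len ih => exact ⟨ih, fun v => add_pos_of_nonneg_of_pos zero_le hε⟩

lemma continuous_length_stretch {m : ℕ} (T : LayeredTree m) :
    Continuous fun ε : ℝ≥0 => (T.stretch ε).length := by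
  induction T with
  | source => exact continuous_const
  | addLayer T n hn parent len ih =>
    simp only [stretch, length]
    fun_prop

lemma continuous_depth_stretch {m : ℕ} (T : LayeredTree m) (t : Fin m) :
    Continuous fun ε : ℝ≥0 => (T.stretch ε).depth t := by
  induction T with
  | source => exact continuous_const
  | addLayer T n hn parent len ih =>
    have := ih (parent t)
    simp only [stretch, depth]
    fun_prop

lemma stretch_zero {m : ℕ} (T : LayeredTree m) : T.stretch 0 = T := by
  induction T with
  | source => rfl
  | addLayer T n hn parent len ih => simp [stretch, ih]

lemma edgeSum_le_stretch {f : ℝ → ℝ → ℝ} (hf : ∀ a b, 0 ≤ f a b) (ε : ℝ≥0) {m : ℕ}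
    (T : LayeredTree m) (x y : Fin m → ℝ) : edgeSum f T x y ≤ edgeSum f (T.stretch ε) x y := by
  induction T with
  | source => exact le_rfl
  | addLayer T n hn parent len ih =>
    rw [stretch, edgeSum, edgeSum]
    refine add_le_add (ih _ _) (sum_le_sum fun v _ => mul_le_mul_of_nonneg_right ?_ (hf _ _))
    exact_mod_cast le_self_add

lemma nonempty_fin {m : ℕ} (T : LayeredTree m) : Nonempty (Fin m) := by
  cases T with
  | source => exact ⟨0⟩
  | addLayer T n hn parent len => exact ⟨⟨0, hn⟩⟩

lemma exists_isElectric_univ {m : ℕ} (T : LayeredTree m) (hT : T.PosLengths) :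
    ∃ x U V, IsElectric T univ x U V ∧ ∀ v, U v = 0 := by
  have := T.nonempty_fin
  obtain ⟨x, U, V, h, hU⟩ := exists_isElectric T hT univ univ_nonempty (fun _ => 0) fun _ => le_rfl
  exact ⟨x, U, V, h, fun v => by rw [hU v (mem_univ v), zero_mul]⟩

open Classical in
/-- The electrical flow from the source to the last layer. -/
noncomputable def electricFlow {m : ℕ} (T : LayeredTree m) : Fin m → ℝ :=
  if hT : T.PosLengths then (exists_isElectric_univ T hT).choose else 0

lemma electricFlow_spec {m : ℕ} {T : LayeredTree m} (hT : T.PosLengths) :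
    ∃ U V, IsElectric T univ T.electricFlow U V ∧ ∀ v, U v = 0 := by
  rw [electricFlow, dif_pos hT]
  exact (exists_isElectric_univ T hT).choose_spec

lemma push_single {n m : ℕ} (parent : Fin n → Fin m) (t : Fin n) :
    push parent (Pi.single t 1) = Pi.single (parent t) 1 := by
  funext p
  rw [push, sum_filter, sum_eq_single t]
  · simp [Pi.single_apply, eq_comm]
  · intro v _ hv
    simp [hv]
  · simp

lemma edgeSum_single {m : ℕ} (T : LayeredTree m) (x : Fin m → ℝ) (t : Fin m) :
    edgeSum (fun _ b => b) T x (Pi.single t 1) = T.depth t := by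
  induction T with
  | source => rfl
  | addLayer T n hn parent len ih =>
    rw [edgeSum, push_single, ih, depth, sum_eq_single t] <;> simp +contextual

lemma depth_nonneg {m : ℕ} (T : LayeredTree m) (t : Fin m) : 0 ≤ T.depth t := by
  induction T with
  | source => exact le_rfl
  | addLayer T n hn parent len ih => exact add_nonneg (ih _) (len t).2

lemma edgeSum_right (f : ℝ → ℝ) {m : ℕ} (T : LayeredTree m) (x y : Fin m → ℝ) :
    edgeSum (fun _ b => f b) T x y = edgeSum (fun a _ => f a) T y y := by
  rw [edgeSum_swap]
  exact edgeSum_left f T y x y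

/-- The last two terms are mean depths and telescope over time, so it suffices to bound upward
movement. -/
lemma edgeSum_abs_eq {m : ℕ} (T : LayeredTree m) (x y : Fin m → ℝ) :
    edgeSum (fun a b => |a - b|) T x y = 2 * edgeSum (fun a b => max (a - b) 0) T x y
      - edgeSum (fun a _ => a) T x x + edgeSum (fun a _ => a) T y y := by
  have h : (fun a b : ℝ => |a - b|) = fun a b => 2 * max (a - b) 0 + (-1 * a + b) := by
    funext a b
    rcases le_total a b with h | h
    · rw [abs_of_nonpos (sub_nonpos.2 h), max_eq_right (sub_nonpos.2 h)]; ring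
    · rw [abs_of_nonneg (sub_nonneg.2 h), max_eq_left (sub_nonneg.2 h)]; ring
  rw [h, edgeSum_add (fun a b => 2 * max (a - b) 0) (fun a b => -1 * a + b), edgeSum_const_mul,
    edgeSum_add (fun a _ => -1 * a) (fun _ b => b), edgeSum_const_mul,
    edgeSum_right (fun b => b), edgeSum_left (fun a => a) T x y x]
  ring

/-- By reciprocity with the unit flow into `t` alone, `V` is the length of the path to `t` with each
edge weighted by its current, which is at most one. -/
lemma IsElectric.potential_source_le {m : ℕ} {T : LayeredTree m} {x U : Fin m → ℝ} {V : ℝ}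
    (h : IsElectric T univ x U V) (hU : ∀ v, U v = 0) (t : Fin m) : V ≤ T.depth t := by
  have h1 := h.edgeSum_mul_add (y := Pi.single t 1) (by simp) (by simp)
  simp only [hU, mul_zero, sum_const_zero, add_zero] at h1
  rw [← h1, ← edgeSum_single T x t]
  have key : ∀ {m : ℕ} (T : LayeredTree m) (S : Finset (Fin m)) (x U y : Fin m → ℝ),
      IsElectric T S x U V → (∀ v, 0 ≤ y v) →
      edgeSum (fun a b => a * b) T x y ≤ edgeSum (fun _ b => b) T x y := by
    intro m T
    induction T with
    | source => exact fun _ _ _ _ _ _ => le_rfl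
    | addLayer T n hn parent len ih =>
      intro S x U y h hy
      have hle := h.le_one
      obtain ⟨-, -, U₀, h₀, -⟩ := h
      rw [edgeSum, edgeSum]
      refine add_le_add (ih _ _ _ _ h₀ (push_nonneg parent hy)) (sum_le_sum fun v _ => ?_)
      exact mul_le_mul_of_nonneg_left (mul_le_of_le_one_left (hy v) (hle v)) (len v).2
  refine key T univ x U _ h fun v => ?_
  by_cases hv : v = t
  · simp [hv]
  · simp [hv]

lemma IsElectric.edgeSum_le {κ : ℝ} (hκ : 0 < κ) {m : ℕ} {T : LayeredTree m} {x U : Fin m → ℝ}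
    {V : ℝ} (h : IsElectric T univ x U V) (hU : ∀ v, U v = 0) :
    edgeSum (fun a _ => a) T x x ≤ T.length / κ + κ * V := by
  have h1 := h.edgeSum_mul_add (y := x) (by simp) h.sum_eq_one
  simp only [hU, mul_zero, sum_const_zero, add_zero] at h1
  rw [← h1, ← edgeSum_one T x x, div_eq_inv_mul, ← edgeSum_const_mul, ← edgeSum_const_mul,
    ← edgeSum_add, edgeSum_diag (fun a b => κ⁻¹ * 1 + κ * (a * b))]
  refine edgeSum_mono (fun a b ha _ => ?_) T h.nonneg h.nonneg
  have : κ⁻¹ * 1 + κ * (a * a) - a = κ * (a - κ⁻¹) ^ 2 + a := by field_simp; ring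
  nlinarith [mul_nonneg hκ.le (sq_nonneg (a - κ⁻¹))]

lemma IsElectric.pot_le {κ : ℝ} (hκ : 0 < κ) {m : ℕ} {T : LayeredTree m} {x U : Fin m → ℝ}
    {V : ℝ} (h : IsElectric T univ x U V) (hU : ∀ v, U v = 0) :
    pot κ T x V ≤ 4 * (T.length / κ) + 2 * (κ * V) := by
  have h1 := h.edgeSum_le hκ hU
  have h2 : edgeSum (fun a _ => √a) T x x / √κ
      ≤ T.length / κ + edgeSum (fun a _ => a) T x x := by
    rw [← edgeSum_one T x x, div_eq_inv_mul, div_eq_inv_mul, ← edgeSum_const_mul,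
      ← edgeSum_const_mul, ← edgeSum_add]
    refine edgeSum_mono (fun a b ha _ => ?_) T h.nonneg h.nonneg
    have h3 := Real.sq_sqrt ha
    have h4 : (√κ)⁻¹ ^ 2 = κ⁻¹ := by rw [inv_pow, Real.sq_sqrt hκ.le]
    nlinarith [sq_nonneg ((√κ)⁻¹ - √a), sq_nonneg ((√κ)⁻¹ + √a)]
  have h3 : 0 ≤ edgeSum (fun a _ => if a = 0 then (0 : ℝ) else 1) T x x :=
    edgeSum_nonneg (fun a _ => by split_ifs <;> norm_num) T x x
  have h4 : (2 * T.length - edgeSum (fun a _ => if a = 0 then (0 : ℝ) else 1) T x x) / κ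
      ≤ 2 * (T.length / κ) := by
    rw [← mul_div_assoc]
    gcongr
    linarith
  rw [pot]
  linarith

/-- Induction over layers with the mean depth as second summand; `10` is twice the constant `5` for
upward movement. The strategy walks on `T` but is charged on the stretched tree. -/
lemma fracTravelled_stretch_le {κ : ℝ} (hκ : 0 < κ) {ε : ℝ≥0} (hε : 0 < ε) {m : ℕ}
    (T : LayeredTree m) {U : Fin m → ℝ} {V : ℝ}
    (h : IsElectric (T.stretch ε) univ (T.stretch ε).electricFlow U V) (hU : ∀ v, U v = 0) :
    fracTravelled (fun _ T => (T.stretch ε).electricFlow) T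
      ≤ 10 * pot κ (T.stretch ε) (T.stretch ε).electricFlow V
        + edgeSum (fun a _ => a) (T.stretch ε) (T.stretch ε).electricFlow
            (T.stretch ε).electricFlow := by
  induction T generalizing V with
  | source =>
    obtain ⟨-, -, -, h3⟩ := h
    have : V = 0 := by rw [← h3, hU]
    simp [fracTravelled, stretch, pot, edgeSum, length, this]
  | addLayer T n hn parent len ih =>
    obtain ⟨U₀, V₀, h₀, hU₀⟩ := electricFlow_spec (posLengths_stretch hε T)
    have h1 := ih h₀ hU₀
    have h2 := posPart_le_of_addLayer hκ (posLengths_stretch hε T) hn h₀ hU₀ h hU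
    have h3 := edgeSum_le_stretch (f := fun a b => |a - b|) (fun _ _ => abs_nonneg _) ε T
      (T.stretch ε).electricFlow
      (push parent ((addLayer T n hn parent len).stretch ε).electricFlow)
    rw [edgeSum_abs_eq (T.stretch ε)] at h3
    have h4 : ∑ v, (len v : ℝ) * ((addLayer T n hn parent len).stretch ε).electricFlow v
        ≤ ∑ v, ((len v + ε : ℝ≥0) : ℝ)
          * ((addLayer T n hn parent len).stretch ε).electricFlow v := by
      refine sum_le_sum fun v _ => mul_le_mul_of_nonneg_right ?_ (h.nonneg v)
      exact_mod_cast le_self_add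
    rw [fracTravelled]
    simp only [stretch, edgeSum] at h1 h2 h3 h4 ⊢
    linarith

/-- The length term is `42 = 10 * 4 + 2`: ten times the bound on `pot`, plus two mean depths, one
from travelling and one from the way back to the source before going to the target. -/
theorem fracCost_stretch_le {κ : ℝ} (hκ : 1 ≤ κ) {ε : ℝ≥0} (hε : 0 < ε) {m : ℕ}
    (T : LayeredTree m) (t : Fin m) :
    fracCost (fun _ T => (T.stretch ε).electricFlow) T t
      ≤ 42 * ((T.stretch ε).length / κ + κ * (T.stretch ε).depth t) := by
  have hκ0 : 0 < κ := one_pos.trans_le hκ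
  obtain ⟨U, V, h, hU⟩ := electricFlow_spec (posLengths_stretch hε T)
  have h1 := fracTravelled_stretch_le hκ0 hε T h hU
  have h2 := h.pot_le hκ0 hU
  have h3 := h.edgeSum_le hκ0 hU
  have h4 := h.potential_source_le hU t
  have h5 : edgeSum (fun a b => |a - b|) T (T.stretch ε).electricFlow (Pi.single t 1)
      ≤ edgeSum (fun a _ => a) (T.stretch ε) (T.stretch ε).electricFlow (T.stretch ε).electricFlow
        + (T.stretch ε).depth t := by
    refine (edgeSum_le_stretch (f := fun a b => |a - b|) (fun _ _ => abs_nonneg _) ε T _ _).trans ?_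
    rw [← edgeSum_single (T.stretch ε) (T.stretch ε).electricFlow t,
      edgeSum_left (fun a => a) (T.stretch ε) _ _ (Pi.single t 1), ← edgeSum_add]
    refine edgeSum_mono (fun a b ha hb => ?_) _ h.nonneg fun v => ?_
    · rw [abs_le]; constructor <;> linarith
    · by_cases hv : v = t
      · simp [hv]
      · simp [hv]
  have h6 := (T.stretch ε).depth_nonneg t
  have h7 := mul_le_mul_of_nonneg_left h4 hκ0.le
  have h8 : (T.stretch ε).depth t ≤ κ * (T.stretch ε).depth t := le_mul_of_one_le_left h6 hκ
  have h9 : 0 ≤ (T.stretch ε).length / κ := by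
    rw [← edgeSum_one (T.stretch ε) 0 0]
    exact div_nonneg (edgeSum_nonneg (fun _ _ => zero_le_one) _ _ _) hκ0.le
  rw [fracCost]
  linarith

/-! ### Letting the perturbation of the lengths tend to zero -/

lemma tendsto_push {ι : Type*} {l : Filter ι} {n m : ℕ} (parent : Fin n → Fin m)
    {x : ι → Fin n → ℝ} {y : Fin n → ℝ} (h : Tendsto x l (𝓝 y)) :
    Tendsto (fun i => push parent (x i)) l (𝓝 (push parent y)) := by
  rw [tendsto_pi_nhds] at h ⊢
  exact fun p => tendsto_finsetSum _ fun v _ => h v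

lemma tendsto_edgeSum {ι : Type*} {l : Filter ι} {f : ℝ → ℝ → ℝ}
    (hf : Continuous fun p : ℝ × ℝ => f p.1 p.2) {m : ℕ} (T : LayeredTree m)
    {x x' : ι → Fin m → ℝ} {y y' : Fin m → ℝ} (h : Tendsto x l (𝓝 y)) (h' : Tendsto x' l (𝓝 y')) :
    Tendsto (fun i => edgeSum f T (x i) (x' i)) l (𝓝 (edgeSum f T y y')) := by
  induction T with
  | source => exact tendsto_const_nhds
  | addLayer T n hn parent len ih =>
    refine (ih (tendsto_push parent h) (tendsto_push parent h')).add
      (tendsto_finsetSum _ fun v _ => tendsto_const_nhds.mul ?_)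
    exact (hf.tendsto (y v, y' v)).comp
      (((tendsto_pi_nhds.1 h) v).prodMk_nhds ((tendsto_pi_nhds.1 h') v))

lemma tendsto_fracTravelled {ι : Type*} {l : Filter ι}
    {X : ι → (m : ℕ) → LayeredTree m → Fin m → ℝ} {Y : (m : ℕ) → LayeredTree m → Fin m → ℝ}
    (h : ∀ m T, Tendsto (fun i => X i m T) l (𝓝 (Y m T))) {m : ℕ} (T : LayeredTree m) :
    Tendsto (fun i => fracTravelled (X i) T) l (𝓝 (fracTravelled Y T)) := by
  induction T with
  | source => exact tendsto_const_nhds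
  | addLayer T n hn parent len ih =>
    refine (ih.add (tendsto_edgeSum (by fun_prop) T (h _ _) (tendsto_push parent (h _ _)))).add ?_
    exact tendsto_finsetSum _ fun v _ => tendsto_const_nhds.mul (tendsto_pi_nhds.1 (h _ _) v)

/-- A fractional strategy of small cost, as a limit of electrical flows. -/
theorem exists_fractional_strategy :
    ∃ X : (m : ℕ) → LayeredTree m → Fin m → ℝ,
      (∀ m T v, 0 ≤ X m T v) ∧ (∀ m T, ∑ v, X m T v = 1) ∧
      ∀ κ : ℝ, 1 ≤ κ → ∀ (m : ℕ) (T : LayeredTree m) (t : Fin m),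
        fracCost X T t ≤ 42 * (T.length / κ + κ * T.depth t) := by
  let ε : ℕ → ℝ≥0 := fun n => 1 / ((n : ℝ≥0) + 1)
  have hε : ∀ n, 0 < ε n := fun n => by positivity
  -- Along one fixed nonprincipal ultrafilter the flows converge simultaneously on all trees, so the
  -- limits form a single strategy.
  have hε0 : Tendsto ε (hyperfilter ℕ : Filter ℕ) (𝓝 0) :=
    (tendsto_one_div_add_atTop_nhds_zero_nat (𝕜 := ℝ≥0)).mono_left
      (Nat.cofinite_eq_atTop ▸ hyperfilter_le_cofinite)
  have hflow : ∀ n {m : ℕ} (T : LayeredTree m), (∀ v, (T.stretch (ε n)).electricFlow v ∈ Set.Icc 0 1)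
      ∧ ∑ v, (T.stretch (ε n)).electricFlow v = 1 := by
    intro n m T
    obtain ⟨U, V, h, -⟩ := electricFlow_spec (posLengths_stretch (hε n) T)
    exact ⟨fun v => ⟨h.nonneg v, h.le_one v⟩, h.sum_eq_one⟩
  have hlim : ∀ (m : ℕ) (T : LayeredTree m), ∃ y : Fin m → ℝ,
      Tendsto (fun n => (T.stretch (ε n)).electricFlow) (hyperfilter ℕ : Filter ℕ) (𝓝 y) := by
    intro m T
    have hc : IsCompact (Set.univ.pi fun _ : Fin m => Set.Icc (0 : ℝ) 1) :=
      isCompact_univ_pi fun _ => isCompact_Icc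
    obtain ⟨y, -, hy⟩ := hc.ultrafilter_le_nhds
      ((hyperfilter ℕ).map fun n => (T.stretch (ε n)).electricFlow) (by
        rw [le_principal_iff, Ultrafilter.coe_map, Filter.mem_map]
        exact univ_mem' fun n v _ => (hflow n T).1 v)
    exact ⟨y, hy⟩
  choose Y hY using hlim
  refine ⟨Y, fun m T v => ?_, fun m T => ?_, fun κ hκ m T t => ?_⟩
  · exact ge_of_tendsto' (tendsto_pi_nhds.1 (hY m T) v) fun n => ((hflow n T).1 v).1
  · refine tendsto_nhds_unique (tendsto_finsetSum _ fun v _ => tendsto_pi_nhds.1 (hY m T) v) ?_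
    simp only [(hflow _ T).2]
    exact tendsto_const_nhds
  · have h1 : Tendsto (fun n => fracCost (fun _ T => (T.stretch (ε n)).electricFlow) T t)
        (hyperfilter ℕ : Filter ℕ) (𝓝 (fracCost Y T t)) :=
      (tendsto_fracTravelled hY T).add
        (tendsto_edgeSum (by fun_prop) T (hY m T) tendsto_const_nhds)
    have h2 : Tendsto (fun n => 42 * ((T.stretch (ε n)).length / κ
          + κ * (T.stretch (ε n)).depth t)) (hyperfilter ℕ : Filter ℕ)
        (𝓝 (42 * (T.length / κ + κ * T.depth t))) := by
      have hl := ((continuous_length_stretch T).tendsto 0).comp hε0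
      have hd := ((continuous_depth_stretch T t).tendsto 0).comp hε0
      rw [stretch_zero] at hl hd
      exact ((hl.div_const κ).add (hd.const_mul κ)).const_mul 42
    exact le_of_tendsto_of_tendsto' h1 h2 fun n => fracCost_stretch_le hκ (hε n) T t

/-! ### Optimal transport on a layered tree -/

/-- Split the mass at each parent among its children in proportion to `β`. Where the total is zero,
all masses involved vanish and the value of the quotient is immaterial. -/
lemma exists_lift {ι : Type*} [Fintype ι] {n m : ℕ} (parent : Fin n → Fin m) {β : Fin n → ℝ}
    (hβ : ∀ v, 0 ≤ β v) {π : ι → Fin m → ℝ} (hπ : ∀ i p, 0 ≤ π i p)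
    (hcol : ∀ p, ∑ i, π i p = push parent β p) :
    ∃ σ : ι → Fin n → ℝ, (∀ i v, 0 ≤ σ i v) ∧ (∀ i, push parent (σ i) = π i) ∧
      ∀ v, ∑ i, σ i v = β v := by
  refine ⟨fun i v => β v / push parent β (parent v) * π i (parent v), fun i v => ?_, fun i => ?_,
    fun v => ?_⟩
  · exact mul_nonneg (div_nonneg (hβ v) (push_nonneg parent hβ _)) (hπ i _)
  · funext p
    have h1 : push parent (fun v => β v / push parent β (parent v) * π i (parent v)) p
        = push parent β p / push parent β p * π i p := by
      rw [push, push, sum_div, sum_mul]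
      refine sum_congr rfl fun v hv => ?_
      rw [(mem_filter.1 hv).2, push]
    rw [h1]
    by_cases hp : push parent β p = 0
    · have := hcol p
      rw [hp, sum_eq_zero_iff_of_nonneg fun i _ => hπ i p] at this
      rw [this i (mem_univ i), mul_zero]
    · rw [div_self hp, one_mul]
  · rw [← mul_sum, hcol]
    by_cases hp : push parent β (parent v) = 0
    · have := (hβ v).antisymm (hp ▸ le_push parent hβ v)
      rw [hp, mul_zero, this]
    · rw [div_mul_cancel₀ _ hp]

lemma push_max_sub {n m : ℕ} (parent : Fin n → Fin m) (a b : Fin n → ℝ) (p : Fin m) :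
    push parent (fun v => max (a v - b v) 0) p - push parent (fun v => max (b v - a v) 0) p
      = push parent a p - push parent b p := by
  simp only [push, ← sum_sub_distrib]
  refine sum_congr rfl fun v _ => ?_
  rcases le_total (a v) (b v) with h | h
  · rw [max_eq_right (by linarith), max_eq_left (by linarith)]; ring
  · rw [max_eq_left (by linarith), max_eq_right (by linarith)]; ring

lemma edgeSum_abs_congr {m : ℕ} (T : LayeredTree m) {x y x' y' : Fin m → ℝ}
    (h : ∀ v, x v - y v = x' v - y' v) :
    edgeSum (fun a b => |a - b|) T x y = edgeSum (fun a b => |a - b|) T x' y' := by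
  induction T with
  | source => rfl
  | addLayer T n hn parent len ih =>
    rw [edgeSum, edgeSum, ih (x' := push parent x') (y' := push parent y')]
    · simp only [h]
    · intro p
      simp only [push, ← sum_sub_distrib, h]

/-- Every pair of mass distributions on the last layer has a transport plan whose cost is the sum
over the edges of length times discrepancy. -/
theorem exists_transport {m : ℕ} (T : LayeredTree m) {a b : Fin m → ℝ} (ha : ∀ v, 0 ≤ a v)
    (hb : ∀ v, 0 ≤ b v) (hab : ∑ v, a v = ∑ v, b v) :
    ∃ π : Fin m → Fin m → ℝ, (∀ u v, 0 ≤ π u v) ∧ (∀ u, ∑ v, π u v = a u) ∧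
      (∀ v, ∑ u, π u v = b v) ∧
      ∑ u, ∑ v, π u v * T.dist u v ≤ edgeSum (fun a b => |a - b|) T a b := by
  induction T with
  | source =>
    refine ⟨fun _ _ => a 0, fun _ _ => ha 0, fun u => ?_, fun v => ?_, ?_⟩
    · simp [Subsingleton.elim u 0]
    · rw [Subsingleton.elim v 0]; simpa using hab
    · simp [dist, edgeSum]
  | addLayer T n hn parent len ih =>
    -- Mass common to `a` and `b` stays in place. The excess and the deficit are pushed to the
    -- parent layer, transported there, and lifted back to the children, first at the receiving end
    -- and then at the sending end.
    set α : Fin n → ℝ := fun v => max (a v - b v) 0 with hα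
    set β : Fin n → ℝ := fun v => max (b v - a v) 0 with hβ
    have hα0 : ∀ v, 0 ≤ α v := fun v => le_max_right _ _
    have hβ0 : ∀ v, 0 ≤ β v := fun v => le_max_right _ _
    obtain ⟨π, hπ, hrow, hcol, hcost⟩ := ih (a := push parent α) (b := push parent β)
      (push_nonneg parent hα0) (push_nonneg parent hβ0) (by
        rw [← sub_eq_zero, ← sum_sub_distrib]
        simp only [hα, hβ, push_max_sub]
        rw [sum_sub_distrib, sum_push, sum_push, hab, sub_self])
    rw [edgeSum_abs_congr T (push_max_sub parent a b)] at hcost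
    obtain ⟨σ, hσ, hσp, hσc⟩ := exists_lift parent hβ0 hπ hcol
    obtain ⟨τ, hτ, hτp, hτc⟩ := exists_lift parent hα0 (π := fun v p => σ p v)
      (fun v p => hσ p v) (fun p => by rw [← hrow, ← hσp, sum_push])
    have hτr : ∀ v, ∑ u, τ v u = β v := fun v => by rw [← sum_push parent, hτp, hσc]
    -- No node has both excess and deficit, so the zero diagonal of `dist` causes no discrepancy in
    -- the cost.
    have hτ0 : ∀ u, τ u u = 0 := by
      intro u
      rcases le_total (a u) (b u) with h | h
      · have h1 : τ u u ≤ α u :=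
          hτc u ▸ single_le_sum (f := fun v => τ v u) (fun v _ => hτ v u) (mem_univ u)
        rw [hα] at h1
        simp only [max_eq_right (sub_nonpos.2 h)] at h1
        exact h1.antisymm (hτ u u)
      · have h1 : τ u u ≤ β u :=
          hτr u ▸ single_le_sum (f := fun v => τ u v) (fun v _ => hτ u v) (mem_univ u)
        rw [hβ] at h1
        simp only [max_eq_right (sub_nonpos.2 h)] at h1
        exact h1.antisymm (hτ u u)
    refine ⟨fun u v => (if u = v then min (a u) (b u) else 0) + τ v u, fun u v => ?_, fun u => ?_,
      fun v => ?_, ?_⟩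
    · refine add_nonneg ?_ (hτ v u)
      split_ifs
      · exact le_min (ha u) (hb u)
      · exact le_rfl
    · rw [sum_add_distrib, sum_ite_eq, if_pos (mem_univ u), hτc]
      rcases le_total (a u) (b u) with h | h
      · rw [hα, min_eq_left h]; simp [h]
      · rw [hα, min_eq_right h]; simp [h]
    · rw [sum_add_distrib, sum_ite_eq', if_pos (mem_univ v), hτr]
      rcases le_total (a v) (b v) with h | h
      · rw [hβ, min_eq_left h]; simp [h]
      · rw [hβ, min_eq_right h]; simp [h]
    · have h1 : ∀ u v, ((if u = v then min (a u) (b u) else 0) + τ v u)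
            * (addLayer T n hn parent len).dist u v
          = len u * τ v u + τ v u * T.dist (parent u) (parent v) + len v * τ v u := by
        intro u v
        rw [dist]
        by_cases huv : u = v
        · subst huv
          rw [hτ0]
          simp
        · rw [if_neg huv, if_neg huv]
          ring
      have h2 : ∑ u, ∑ v, τ v u * T.dist (parent u) (parent v)
          = ∑ p, ∑ q, π p q * T.dist p q := by
        rw [sum_comm]
        have h3 : ∀ v, ∑ u, τ v u * T.dist (parent u) (parent v)
            = ∑ p, σ p v * T.dist p (parent v) := fun v => by
          rw [← sum_push_mul parent (τ v) fun p => T.dist p (parent v), hτp]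
        simp only [h3]
        rw [sum_comm]
        refine sum_congr rfl fun p _ => ?_
        rw [← sum_push_mul parent (σ p) fun q => T.dist p q, hσp]
      have h4 : ∑ u, ∑ v, (len u : ℝ) * τ v u = ∑ u, (len u : ℝ) * α u :=
        sum_congr rfl fun u _ => by rw [← mul_sum, hτc]
      have h5 : ∑ u, ∑ v, (len v : ℝ) * τ v u = ∑ v, (len v : ℝ) * β v := by
        rw [sum_comm]
        exact sum_congr rfl fun v _ => by rw [← mul_sum, hτr]
      have h6 : ∑ v, (len v : ℝ) * |a v - b v|
          = ∑ u, (len u : ℝ) * α u + ∑ v, (len v : ℝ) * β v := by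
        rw [← sum_add_distrib]
        refine sum_congr rfl fun v _ => ?_
        rw [← mul_add, hα, hβ]
        rcases le_total (a v) (b v) with h | h
        · simp [h, abs_of_nonpos (sub_nonpos.2 h)]
        · simp [h, abs_of_nonneg (sub_nonneg.2 h)]
      simp only [h1, sum_add_distrib]
      rw [h2, h4, h5, edgeSum, h6]
      linarith

/-- A transport plan from a mass distribution on the last layer to one on a new layer. -/
theorem exists_transport_addLayer {m n : ℕ} (T : LayeredTree m) (parent : Fin n → Fin m)
    (len : Fin n → ℝ≥0) {a : Fin m → ℝ} {b : Fin n → ℝ} (ha : ∀ v, 0 ≤ a v)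
    (hb : ∀ v, 0 ≤ b v) (hab : ∑ v, a v = ∑ v, b v) :
    ∃ σ : Fin m → Fin n → ℝ, (∀ u v, 0 ≤ σ u v) ∧ (∀ u, ∑ v, σ u v = a u) ∧
      (∀ v, ∑ u, σ u v = b v) ∧
      ∑ u, ∑ v, σ u v * (T.dist u (parent v) + len v)
        ≤ edgeSum (fun a b => |a - b|) T a (push parent b) + ∑ v, (len v : ℝ) * b v := by
  obtain ⟨π, hπ, hrow, hcol, hcost⟩ := exists_transport T ha (push_nonneg parent hb)
    (hab.trans (sum_push parent b).symm)
  obtain ⟨σ, hσ, hσp, hσc⟩ := exists_lift parent hb hπ hcol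
  refine ⟨σ, hσ, fun u => by rw [← sum_push parent, hσp, hrow], hσc, ?_⟩
  simp only [mul_add, sum_add_distrib]
  refine add_le_add (le_trans (le_of_eq ?_) hcost) (le_of_eq ?_)
  · refine sum_congr rfl fun u _ => ?_
    rw [← sum_push_mul parent (σ u) fun q => T.dist u q, hσp]
  · rw [sum_comm]
    exact sum_congr rfl fun v _ => by rw [← sum_mul, hσc, mul_comm]

open ProbabilityTheory

/-! ### From fractional strategies to randomized algorithms -/

/-- The number of layers after the source. -/
def layers : {m : ℕ} → LayeredTree m → ℕ
  | _, source => 0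
  | _, addLayer T _ _ _ _ => T.layers + 1

/-- The σ-algebra generated by the decisions on trees with fewer than `h` layers. -/
abbrev past (h : ℕ) : MeasurableSpace DetAlgorithm :=
  ⨆ s ∈ {s : Situation | s.tree.layers < h},
    MeasurableSpace.comap (fun a : DetAlgorithm => a s) inferInstance

lemma measurable_decision (s : Situation) : Measurable fun a : DetAlgorithm => a s :=
  measurable_pi_apply (X := fun s : Situation => Fin s.n) s

lemma past_le (h : ℕ) : past h ≤ (inferInstance : MeasurableSpace DetAlgorithm) :=
  iSup₂_le fun s _ => (measurable_decision s).comap_le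

lemma past_mono {h h' : ℕ} (hh : h ≤ h') : past h ≤ past h' :=
  biSup_mono fun _ hs => lt_of_lt_of_le hs hh

lemma measurableSet_past_decision {h : ℕ} {s : Situation} (hs : s.tree.layers < h) (v : Fin s.n) :
    MeasurableSet[past h] {a : DetAlgorithm | a s = v} := by
  refine le_biSup (fun s : Situation => MeasurableSpace.comap (fun a : DetAlgorithm => a s)
    inferInstance) (show s ∈ {s : Situation | s.tree.layers < h} from hs) _ ?_
  exact ⟨{v}, measurableSet_singleton v, rfl⟩

/-- Reaching the last layer of `T` uses only decisions taken on strictly shorter prefixes; hence the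
next decision is independent of the position on `T`. -/
lemma measurableSet_past_position {m : ℕ} (T : LayeredTree m) (u : Fin m) :
    MeasurableSet[past T.layers] {a : DetAlgorithm | position a T = u} := by
  induction T with
  | source =>
    have h1 : {a : DetAlgorithm | position a source = u} = Set.univ :=
      Set.eq_univ_of_forall fun a => Subsingleton.elim _ _
    rw [h1]
    exact MeasurableSet.univ
  | @addLayer m T n hn parent len ih =>
    have h1 : {a : DetAlgorithm | position a (addLayer T n hn parent len) = u}
        = ⋃ w, {a : DetAlgorithm | position a T = w}
          ∩ {a : DetAlgorithm | a ⟨m, T, w, n, hn, parent, len⟩ = u} := by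
      ext a
      simp only [Set.mem_ofPred_eq, Set.mem_iUnion, Set.mem_inter_iff]
      constructor
      · exact fun h => ⟨_, rfl, h⟩
      · rintro ⟨w, rfl, h⟩
        exact h
    rw [h1]
    refine MeasurableSet.iUnion fun w => MeasurableSet.inter ?_ ?_
    · exact past_mono (Nat.le_succ _) _ (ih w)
    · exact measurableSet_past_decision (s := ⟨m, T, w, n, hn, parent, len⟩) (Nat.lt_succ_self _) u

lemma measurable_position {m : ℕ} (T : LayeredTree m) :
    Measurable fun a : DetAlgorithm => position a T :=
  measurable_to_countable' fun u => past_le _ _ (measurableSet_past_position T u)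

lemma integral_comp_fintype {Ω β : Type*} [MeasurableSpace Ω] {μ : Measure Ω}
    [IsProbabilityMeasure μ] [Fintype β] [MeasurableSpace β] [MeasurableSingletonClass β]
    {f : Ω → β} (hf : Measurable f) (F : β → ℝ) :
    Integrable (fun a => F (f a)) μ ∧ ∫ a, F (f a) ∂μ = ∑ b, μ.real (f ⁻¹' {b}) * F b := by
  have : IsProbabilityMeasure (μ.map f) := Measure.isProbabilityMeasure_map hf.aemeasurable
  have hF : Integrable F (μ.map f) := Integrable.of_finite
  refine ⟨hF.comp_measurable hf, ?_⟩
  rw [← integral_map hf.aemeasurable hF.aestronglyMeasurable, integral_fintype hF]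
  refine sum_congr rfl fun b _ => ?_
  rw [map_measureReal_apply hf (measurableSet_singleton b), smul_eq_mul]

lemma exists_measure_of_sum {n : ℕ} (hn : 0 < n) {c : Fin n → ℝ} (hc : ∀ v, 0 ≤ c v) :
    ∃ ν : Measure (Fin n), IsProbabilityMeasure ν ∧ ∀ v, (∑ w, c w) * ν.real {v} = c v := by
  by_cases hs : ∑ w, c w = 0
  -- Zero total mass means a position occupied with probability zero, so any decision serves.
  · refine ⟨Measure.dirac ⟨0, hn⟩, inferInstance, fun v => ?_⟩
    rw [hs, zero_mul, (sum_eq_zero_iff_of_nonneg fun w _ => hc w).1 hs v (mem_univ v)]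
  · have hs0 : 0 < ∑ w, c w := lt_of_le_of_ne (sum_nonneg fun w _ => hc w) (Ne.symm hs)
    have h1 : ∑ v, ENNReal.ofReal (c v / ∑ w, c w) = 1 := by
      rw [← ENNReal.ofReal_sum_of_nonneg fun v _ => div_nonneg (hc v) hs0.le, ← sum_div,
        div_self hs, ENNReal.ofReal_one]
    refine ⟨(PMF.ofFintype _ h1).toMeasure, inferInstance, fun v => ?_⟩
    rw [Measure.real, PMF.toMeasure_apply_singleton _ _ (measurableSet_singleton v),
      PMF.ofFintype_apply, ENNReal.toReal_ofReal (div_nonneg (hc v) hs0.le), mul_div_cancel₀ _ hs]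

/-- Decisions on a tree are independent of the position reached on it. -/
lemma measureReal_inter_decision (P : (s : Situation) → Measure (Fin s.n))
    [∀ s, IsProbabilityMeasure (P s)] {μ : Measure DetAlgorithm}
    (hμ : μ = Measure.infinitePi P) {m : ℕ} (T : LayeredTree m) (u : Fin m) {s : Situation}
    (hs : s.tree.layers = T.layers) (v : Fin s.n) :
    μ.real ({a | position a T = u} ∩ {a | a s = v})
      = μ.real {a | position a T = u} * (P s).real {v} := by
  have hind : iIndepFun (fun (s : Situation) (a : DetAlgorithm) => a s) μ := by
    rw [hμ]
    exact iIndepFun_infinitePi (X := fun _ w => w) fun _ => measurable_id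
  have h1 := indep_iSup_of_disjoint (fun s => (measurable_decision s).comap_le) hind
    (S := {s : Situation | s.tree.layers < T.layers}) (T := {s}) (by
      rw [Set.disjoint_singleton_right, Set.mem_ofPred_eq, hs]
      exact lt_irrefl _)
  rw [_root_.iSup_singleton] at h1
  have h2 := (Indep_iff _ _ μ).1 h1 _ {a | a s = v} (measurableSet_past_position T u)
    ⟨{v}, measurableSet_singleton v, rfl⟩
  have h3 : μ {a | a s = v} = P s {v} := by
    have := measurePreserving_eval_infinitePi P s
    rw [hμ, ← this.measure_preimage (measurableSet_singleton v).nullMeasurableSet]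
    rfl
  rw [Measure.real, h2, ENNReal.toReal_mul, h3]
  rfl

/-- Every fractional strategy is realized by a randomized algorithm. -/
theorem exists_randAlgorithm {X : (m : ℕ) → LayeredTree m → Fin m → ℝ}
    (hX : ∀ m T v, 0 ≤ X m T v) (hX1 : ∀ m T, ∑ v, X m T v = 1) :
    ∃ A : RandAlgorithm, ∀ (m : ℕ) (T : LayeredTree m) (t : Fin m),
      Integrable (fun a => cost a T t) (A : Measure DetAlgorithm) ∧
      ∫ a, cost a T t ∂(A : Measure DetAlgorithm) ≤ fracCost X T t := by
  have hplan := fun (m n : ℕ) (T : LayeredTree m) (hn : 0 < n) (parent : Fin n → Fin m)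
      (len : Fin n → ℝ≥0) => exists_transport_addLayer T parent len (hX m T)
        (hX n (addLayer T n hn parent len)) ((hX1 _ _).trans (hX1 _ _).symm)
  choose σ hσ hrow hcol hcost using hplan
  have hker := fun s : Situation =>
    exists_measure_of_sum s.hn (hσ s.m s.n s.tree s.hn s.parent s.len s.pos)
  choose P hP hPσ using hker
  obtain ⟨μ, hμ⟩ : ∃ μ : Measure DetAlgorithm, μ = Measure.infinitePi P := ⟨_, rfl⟩
  have hμP : IsProbabilityMeasure μ := by
    rw [hμ]; exact inferInstanceAs (IsProbabilityMeasure (Measure.infinitePi P))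
  have hjoint : ∀ {m : ℕ} (T : LayeredTree m) (n : ℕ) (hn : 0 < n) (parent : Fin n → Fin m)
      (len : Fin n → ℝ≥0), (∀ u, μ.real {a | position a T = u} = X m T u) → ∀ u v,
      μ.real ((fun a => (position a T, position a (addLayer T n hn parent len))) ⁻¹' {(u, v)})
        = σ m n T hn parent len u v := by
    intro m T n hn parent len hlaw u v
    have h1 : (fun a => (position a T, position a (addLayer T n hn parent len))) ⁻¹' {(u, v)}
        = {a | position a T = u} ∩ {a | a ⟨m, T, u, n, hn, parent, len⟩ = v} := by
      ext a
      simp only [Set.mem_preimage, Set.mem_singleton_iff, Prod.mk.injEq, Set.mem_inter_iff,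
        Set.mem_ofPred_eq]
      refine and_congr_right ?_
      rintro rfl
      rfl
    rw [h1, measureReal_inter_decision P hμ T u (s := ⟨m, T, u, n, hn, parent, len⟩) rfl v, hlaw,
      ← hrow m n T hn parent len u]
    exact hPσ ⟨m, T, u, n, hn, parent, len⟩ v
  -- The position has law `X` on every tree: by `hjoint`, two consecutive positions are jointly
  -- distributed as the transport plan, whose second marginal is the next distribution.
  have hlaw : ∀ {m : ℕ} (T : LayeredTree m) (u : Fin m),
      μ.real {a | position a T = u} = X m T u := by
    intro m T
    induction T with
    | source =>
      intro u
      have h1 : {a : DetAlgorithm | position a source = u} = Set.univ :=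
        Set.eq_univ_of_forall fun a => Subsingleton.elim _ _
      have h2 := hX1 1 source
      rw [Fin.sum_univ_one] at h2
      rw [h1, Subsingleton.elim u 0, h2, probReal_univ]
    | @addLayer m T n hn parent len ih =>
      intro v
      have h1 := integral_comp_fintype (μ := μ) ((measurable_position T).prodMk
        (measurable_position (addLayer T n hn parent len))) fun p => if p.2 = v then 1 else 0
      have h2 := integral_comp_fintype (μ := μ) (measurable_position (addLayer T n hn parent len))
        fun w => if w = v then 1 else 0
      have h3 := h1.2.symm.trans h2.2
      simp only [mul_ite, mul_one, mul_zero, sum_ite_eq', mem_univ, if_true, Fintype.sum_prod_type,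
        hjoint T n hn parent len ih, hcol] at h3
      exact h3.symm
  have htrav : ∀ {m : ℕ} (T : LayeredTree m), Integrable (fun a => travelled a T) μ ∧
      ∫ a, travelled a T ∂μ ≤ fracTravelled X T := by
    intro m T
    induction T with
    | source => simp [travelled, fracTravelled]
    | @addLayer m T n hn parent len ih =>
      have h1 := integral_comp_fintype (μ := μ) ((measurable_position T).prodMk
        (measurable_position (addLayer T n hn parent len)))
        fun p => T.dist p.1 (parent p.2) + len p.2
      rw [Fintype.sum_prod_type] at h1
      simp only [hjoint T n hn parent len (hlaw T)] at h1
      refine ⟨ih.1.add h1.1, ?_⟩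
      simp only [travelled]
      rw [integral_add ih.1 h1.1, h1.2, fracTravelled, add_assoc]
      exact add_le_add ih.2 (hcost m n T hn parent len)
  refine ⟨⟨μ, hμP⟩, fun m T t => ?_⟩
  have h1 := integral_comp_fintype (μ := μ) (measurable_position T) fun u => T.dist u t
  have h2 := htrav T
  refine ⟨h2.1.add h1.1, ?_⟩
  change ∫ a, travelled a T + T.dist (position a T) t ∂μ ≤ _
  rw [integral_add h2.1 h1.1, h1.2, fracCost]
  refine add_le_add h2.2 ?_
  obtain ⟨π, hπ, hr, hc, hd⟩ := exists_transport T (hX m T) (b := Pi.single t 1)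
    (fun v => by by_cases hv : v = t <;> simp [hv]) (by rw [hX1]; simp)
  refine le_trans (le_of_eq (sum_congr rfl fun u _ => ?_)) hd
  -- The plan into a point mass is forced, so its cost is exactly the expected distance to `t`.
  have h0 : ∀ v, v ≠ t → π u v = 0 := by
    intro v hv
    have := hc v
    rw [Pi.single_eq_of_ne hv, sum_eq_zero_iff_of_nonneg fun w _ => hπ w v] at this
    exact this u (mem_univ u)
  rw [sum_eq_single t (fun v _ hv => by rw [h0 v hv, zero_mul]) (by simp)]
  have h3 := hr u
  rw [sum_eq_single t (fun v _ hv => h0 v hv) (by simp)] at h3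
  rw [h3, ← hlaw T u]
  rfl

/-! ### Unit edge lengths -/

lemma one_le_width {m : ℕ} (T : LayeredTree m) : 1 ≤ T.width := by
  induction T with
  | source => exact le_rfl
  | addLayer T n hn parent len ih => exact ih.trans (le_max_left _ _)

lemma length_le_width_mul_depth {m : ℕ} (T : LayeredTree m) (hT : T.UnitLengths) {w : ℕ}
    (hw : T.width ≤ w) (t : Fin m) : T.length ≤ w * T.depth t := by
  induction T with
  | source => simp [length, depth]
  | addLayer T n hn parent len ih =>
    obtain ⟨hT, hlen⟩ := hT
    have h1 := ih hT ((le_max_left _ _).trans hw) (parent t)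
    have h2 : (n : ℝ) ≤ w := by exact_mod_cast (le_max_right _ _).trans hw
    simp only [length, depth, hlen, NNReal.coe_one, sum_const, card_univ, Fintype.card_fin,
      nsmul_eq_mul, mul_one]
    linarith

end LayeredTree

/-! ### Choice of parameters -/

theorem mainTheorem2 :
    ∃ (A : ℕ → LayeredTree.RandAlgorithm) (C : ℝ),
      (∀ k : ℕ, 1 ≤ k → ∀ (m : ℕ) (T : LayeredTree m) (t : Fin m),
        Integrable (fun a => LayeredTree.cost a T t) (A k : Measure LayeredTree.DetAlgorithm) ∧
        ∫ a, LayeredTree.cost a T t ∂(A k : Measure LayeredTree.DetAlgorithm)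
          ≤ 2 * T.length / k + C * (k * T.depth t)) ∧
      ∃ C' : ℝ, ∀ (w m : ℕ) (T : LayeredTree m) (t : Fin m), T.UnitLengths → T.width ≤ w →
        Integrable (fun a => LayeredTree.cost a T t)
          (A ⌊√(w : ℝ)⌋₊ : Measure LayeredTree.DetAlgorithm) ∧
        ∫ a, LayeredTree.cost a T t ∂(A ⌊√(w : ℝ)⌋₊ : Measure LayeredTree.DetAlgorithm)
          ≤ C' * (√(w : ℝ) * T.depth t) := by
  obtain ⟨X, hX, hX1, hcost⟩ := LayeredTree.exists_fractional_strategy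
  obtain ⟨A, hA⟩ := LayeredTree.exists_randAlgorithm hX hX1
  have hbound : ∀ k : ℕ, 1 ≤ k → ∀ (m : ℕ) (T : LayeredTree m) (t : Fin m),
      ∫ a, LayeredTree.cost a T t ∂(A : Measure LayeredTree.DetAlgorithm)
        ≤ 2 * T.length / k + 882 * (k * T.depth t) := by
    intro k hk m T t
    have hk' : (1 : ℝ) ≤ k := by exact_mod_cast hk
    -- With `κ = 21 * k` the length coefficient is `42 / 21 = 2` and the distance coefficient `42 *
    -- 21 = 882`.
    refine ((hA m T t).2.trans (hcost (21 * k) (by linarith) m T t)).trans (le_of_eq ?_)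
    field_simp
    ring
  refine ⟨fun _ => A, 882, fun k hk m T t => ⟨(hA m T t).1, hbound k hk m T t⟩, 886, ?_⟩
  intro w m T t hT hw
  refine ⟨(hA m T t).1, ?_⟩
  have hw1 : (1 : ℝ) ≤ √(w : ℝ) :=
    Real.one_le_sqrt.2 (by exact_mod_cast T.one_le_width.trans hw)
  have hk : 1 ≤ ⌊√(w : ℝ)⌋₊ := Nat.le_floor (by simpa using hw1)
  refine (hbound _ hk m T t).trans ?_
  have hle : (⌊√(w : ℝ)⌋₊ : ℝ) ≤ √(w : ℝ) := Nat.floor_le (by positivity)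
  have hlt : √(w : ℝ) < ⌊√(w : ℝ)⌋₊ + 1 := Nat.lt_floor_add_one _
  have hk' : (1 : ℝ) ≤ (⌊√(w : ℝ)⌋₊ : ℝ) := by exact_mod_cast hk
  have hD := T.depth_nonneg t
  have hL := T.length_le_width_mul_depth hT hw t
  -- Since `L ≤ w * D` and `√w` is at most twice its floor, the length term adds `4` to `882`, hence
  -- `886`.
  have h1 : 2 * T.length / (⌊√(w : ℝ)⌋₊ : ℝ) ≤ 4 * (√(w : ℝ) * T.depth t) := by
    rw [div_le_iff₀ (by linarith)]
    have hsq : √(w : ℝ) * √(w : ℝ) = w := Real.mul_self_sqrt (by positivity)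
    have h2 : √(w : ℝ) ≤ 2 * (⌊√(w : ℝ)⌋₊ : ℝ) := by linarith
    have h3 := mul_le_mul_of_nonneg_left h2 (mul_nonneg (Real.sqrt_nonneg (w : ℝ)) hD)
    have h4 : √(w : ℝ) * T.depth t * √(w : ℝ) = w * T.depth t := by
      linear_combination T.depth t * hsq
    linarith
  have h2 : (⌊√(w : ℝ)⌋₊ : ℝ) * T.depth t ≤ √(w : ℝ) * T.depth t :=
    mul_le_mul_of_nonneg_right hle hD
  linarith
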